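/- Let $p$ be a prime number, $G=SL_2$ over $\mathbb F_p$, and let $\mathrm{Dist}(G)$ be its algebra of distributions: the $\mathbb F_p$-linear forms on $\mathbb F_p[G]$ vanishing on some power of the augmentation ideal, with the convolution product. Let $\mathrm{Dist}(\mathrm{Fr}):\mathrm{Dist}(G)\to\mathrm{Dist}(G)$ be the map $\mu\mapsto(f\mapsto\mu(f^p))$ induced by the Frobenius endomorphism of $G$. Let $X^{(n)}$, $Y^{(n)}$, $\binom Hn\in\mathrm{Dist}(G)$ $(n\in\mathbb N)$ be the distributions sending $f$ to the coefficient of $u^n$ in $f\begin{pmatrix}1&u\\0&1\end{pmatrix}$, $f\begin{pmatrix}1&0\\u&1\end{pmatrix}$, $f\begin{pmatrix}1+u&0\\0&(1+u)^{-1}\end{pmatrix}\in\mathbb F_p[[u]]$ respectively (the usual divided powers and binomials of the standard basis of $\mathfrak{sl}_2$). For $m\in\mathbb Z$ put $\binom{H+m}{n}=\sum_{i+j=n}\binom mi\binom Hj$, and for $r\in\mathbb N$, $n\in\mathbb Z$ put $$\mu_n^{(r)}=\sum_{i=0}^{p^r-1}(-1)^i\binom{H-n}{i},\qquad \mu_0:=\mu_0^{(1)}.$$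 (i) There is a unique $\mathbb F_p$-linear map $\mathrm{Fr}':\mathrm{Dist}(G)\to\mathrm{Dist}(G)$ such that $\mathrm{Fr}'\binom Hm=\binom H{pm}$ for all $m\in\mathbb N$ and $$\mathrm{Fr}'\bigl(X^{(a)}\mu_n^{(1+b)}Y^{(c)}\bigr)=X^{(pa)}\,\mathrm{Fr}'\bigl(\mu_n^{(1+b)}\bigr)\,Y^{(pc)}\qquad(a,b,c\in\mathbb N,\ n\in\mathbb Z).$$ (ii) The $\mathbb F_p$-subspace $$S=\sum_{a,b,c\in\mathbb N}\ \sum_{0\le n<p^b}\mathbb F_p\,X^{(pa)}Y^{(pc)}\mu_{np}^{(1+b)}$$ of $\mathrm{Dist}(G)$ is closed under multiplication, and is an $\mathbb F_p$-algebra with unit element $\mu_0$. For every $\mu\in\mathrm{Dist}(G)$ one has $\mu_0\mathrm{Fr}'(\mu)\mu_0=\mathrm{Fr}'(\mu)\mu_0$, and $$\phi:\mathrm{Dist}(G)\to S,\qquad \phi(\mu)=\mathrm{Fr}'(\mu)\mu_0,$$ is an isomorphism of $\mathbb F_p$-algebras (sending $1$ to $\mu_0$) such that $\mathrm{Dist}(\mathrm{Fr})\circ\phi=\mathrm{id}_{\mathrm{Dist}(G)}$.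 -/

import Mathlib

open scoped TensorProduct
open WithConv

/-! ### The algebra of distributions of an affine group scheme -/

section Distributions

variable (k A : Type*) [CommRing k] [CommRing A] [Bialgebra k A]

/-- The augmentation ideal of `A = k[G]`: the functions vanishing at the neutral element. -/
def augIdeal : Ideal A := RingHom.ker (Bialgebra.counitAlgHom k A)

variable {k A}

theorem mem_augIdeal {f : A} : f ∈ augIdeal k A ↔ Coalgebra.counit (R := k) f = 0 := Iff.rfl

theorem comul_mem_of_mem_augIdeal {f : A} (hf : f ∈ augIdeal k A) :
    Bialgebra.comulAlgHom k A f ∈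
      (augIdeal k A).map (Algebra.TensorProduct.includeLeft : A →ₐ[k] A ⊗[k] A) ⊔
      (augIdeal k A).map (Algebra.TensorProduct.includeRight : A →ₐ[k] A ⊗[k] A) := by
  have hs : Function.Surjective (Bialgebra.counitAlgHom k A) := fun c =>
    ⟨algebraMap k A c, by simp⟩
  have := Algebra.TensorProduct.map_ker (Bialgebra.counitAlgHom k A)
    (Bialgebra.counitAlgHom k A) hs hs
  unfold augIdeal
  rw [← this, RingHom.mem_ker]
  have h1 : Algebra.TensorProduct.map (Bialgebra.counitAlgHom k A) (Bialgebra.counitAlgHom k A) =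
      (Algebra.TensorProduct.map (AlgHom.id k k) (Bialgebra.counitAlgHom k A)).comp
        (Algebra.TensorProduct.map (Bialgebra.counitAlgHom k A) (AlgHom.id k A)) := by
    ext <;> simp
  have h2 : Algebra.TensorProduct.map (Bialgebra.counitAlgHom k A) (AlgHom.id k A)
      (Bialgebra.comulAlgHom k A f) = (1 : k) ⊗ₜ[k] f :=
    Coalgebra.rTensor_counit_comul f
  rw [h1, AlgHom.comp_apply, h2]
  simp [mem_augIdeal.1 hf]

theorem comul_mem_of_mem_augIdeal_pow {m n : ℕ} {f : A} (hf : f ∈ augIdeal k A ^ (m + n)) :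
    Bialgebra.comulAlgHom k A f ∈
      (augIdeal k A ^ m).map (Algebra.TensorProduct.includeLeft : A →ₐ[k] A ⊗[k] A) ⊔
      (augIdeal k A ^ n).map (Algebra.TensorProduct.includeRight : A →ₐ[k] A ⊗[k] A) := by
  have h : augIdeal k A ≤ Ideal.comap (Bialgebra.comulAlgHom k A)
      ((augIdeal k A).map (Algebra.TensorProduct.includeLeft : A →ₐ[k] A ⊗[k] A) ⊔
      (augIdeal k A).map (Algebra.TensorProduct.includeRight : A →ₐ[k] A ⊗[k] A)) :=
    fun f hf => comul_mem_of_mem_augIdeal hf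
  have h' := Ideal.le_comap_pow (Bialgebra.comulAlgHom k A) (m + n) (Ideal.pow_right_mono h _ hf)
  rw [Ideal.mem_comap] at h'
  rw [Ideal.map_pow, Ideal.map_pow]
  exact Ideal.sup_pow_add_le_pow_sup_pow h'

theorem map_eq_zero_of_mem_sup {I J : Ideal A} {μ ν : A →ₗ[k] k}
    (hμ : ∀ f ∈ I, μ f = 0) (hν : ∀ f ∈ J, ν f = 0) {z : A ⊗[k] A}
    (hz : z ∈ I.map (Algebra.TensorProduct.includeLeft : A →ₐ[k] A ⊗[k] A) ⊔
      J.map (Algebra.TensorProduct.includeRight : A →ₐ[k] A ⊗[k] A)) :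
    TensorProduct.map μ ν z = 0 := by
  obtain ⟨x, hx, y, hy, rfl⟩ := Submodule.mem_sup.1 hz
  rw [map_add]
  have h1 : TensorProduct.map μ ν x = 0 := by
    refine Submodule.span_induction (p := fun x _ => ∀ w, TensorProduct.map μ ν (w * x) = 0)
      ?_ ?_ ?_ ?_ hx 1 |> fun h => by simpa using h
    · rintro _ ⟨f, hf, rfl⟩ w
      induction w with
      | zero => simp
      | tmul a b => simp [hμ _ (I.mul_mem_left a hf)]
      | add a b ha hb => rw [add_mul, map_add, ha, hb, add_zero]
    · simp
    · intro a b _ _ ha hb w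
      rw [mul_add, map_add, ha, hb, add_zero]
    · intro a b _ hb w
      rw [smul_eq_mul, ← mul_assoc, hb]
  have h2 : TensorProduct.map μ ν y = 0 := by
    refine Submodule.span_induction (p := fun x _ => ∀ w, TensorProduct.map μ ν (w * x) = 0)
      ?_ ?_ ?_ ?_ hy 1 |> fun h => by simpa using h
    · rintro _ ⟨f, hf, rfl⟩ w
      induction w with
      | zero => simp
      | tmul a b => simp [hν _ (J.mul_mem_left b hf)]
      | add a b ha hb => rw [add_mul, map_add, ha, hb, add_zero]
    · simp
    · intro a b _ _ ha hb w
      rw [mul_add, map_add, ha, hb, add_zero]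
    · intro a b _ hb w
      rw [smul_eq_mul, ← mul_assoc, hb]
  rw [h1, h2, add_zero]

variable (k A) in
/-- `Dist(G)` for the affine group (or monoid) scheme `G` over `k` with coordinate ring `A`:
the `k`-linear forms on `A` that vanish on a power of the augmentation ideal, with the
convolution product `(μν)(f) = (μ ⊗ ν)(Δ f)`, whose unit is the counit (evaluation at `1`). -/
def DistAlg : Subalgebra k (WithConv (A →ₗ[k] k)) where
  carrier := {μ | ∃ n : ℕ, ∀ f ∈ augIdeal k A ^ n, μ f = 0}
  mul_mem' := by
    rintro μ ν ⟨m, hm⟩ ⟨n, hn⟩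
    refine ⟨m + n, fun f hf => ?_⟩
    have := map_eq_zero_of_mem_sup (μ := μ.ofConv) (ν := ν.ofConv) hm hn
      (comul_mem_of_mem_augIdeal_pow hf)
    rw [LinearMap.convMul_apply]
    exact (congrArg _ this).trans (map_zero _)
  add_mem' := by
    rintro μ ν ⟨m, hm⟩ ⟨n, hn⟩
    refine ⟨m + n, fun f hf => ?_⟩
    have h1 := hm f (Ideal.pow_le_pow_right (Nat.le_add_right m n) hf)
    have h2 := hn f (Ideal.pow_le_pow_right (Nat.le_add_left n m) hf)
    change μ f + ν f = 0
    rw [h1, h2, add_zero]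
  algebraMap_mem' := by
    intro c
    refine ⟨1, fun f hf => ?_⟩
    rw [pow_one] at hf
    rw [LinearMap.convAlgebraMap_apply, mem_augIdeal.1 hf]
    simp

/-- The map `Dist(G) → Dist(H)`, `μ ↦ μ ∘ θ`, attached to a morphism `G → H` of schemes
preserving the neutral elements, with comorphism `θ : k[H] → k[G]`. -/
def DistAlg.comap {B : Type*} [CommRing B] [Bialgebra k B] (θ : B →ₐ[k] A)
    (hθ : (Bialgebra.counitAlgHom k A).comp θ = Bialgebra.counitAlgHom k B) :
    DistAlg k A →ₗ[k] DistAlg k B where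
  toFun μ := ⟨toConv (μ.1.ofConv ∘ₗ θ.toLinearMap), by
    obtain ⟨n, hn⟩ := μ.2
    refine ⟨n, fun f hf => hn (θ f) ?_⟩
    have h : augIdeal k B ≤ Ideal.comap θ (augIdeal k A) := by
      intro g hg
      have := DFunLike.congr_fun hθ g
      rw [Ideal.mem_comap, mem_augIdeal]
      exact this.trans hg
    exact Ideal.le_comap_pow θ n (Ideal.pow_right_mono h n hf)⟩
  map_add' _ _ := rfl
  map_smul' _ _ := rfl

/-- For a formal curve in `G` through the neutral element, given by `γ : k[G] → k⟦u⟧`, the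
distribution sending `f` to the coefficient of `u ^ n` in `γ f`. -/
noncomputable def DistAlg.ofCurve (γ : A →ₐ[k] PowerSeries k)
    (hγ : ∀ f, PowerSeries.constantCoeff (γ f) = Coalgebra.counit (R := k) f) (n : ℕ) :
    DistAlg k A :=
  ⟨toConv (PowerSeries.coeff n ∘ₗ γ.toLinearMap), by
    refine ⟨n + 1, fun f hf => ?_⟩
    have h : augIdeal k A ≤ Ideal.comap γ (Ideal.span {PowerSeries.X}) := by
      intro g hg
      rw [Ideal.mem_comap, Ideal.mem_span_singleton, PowerSeries.X_dvd_iff, hγ]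
      exact hg
    have h' := Ideal.le_comap_pow γ (n + 1) (Ideal.pow_right_mono h _ hf)
    rw [Ideal.mem_comap, Ideal.span_singleton_pow, Ideal.mem_span_singleton,
      PowerSeries.X_pow_dvd_iff] at h'
    exact h' n (Nat.lt_succ_self n)⟩

end Distributions

/-! ### The group scheme `SL₂` -/

namespace SLTwo

section CoordRing

variable (k : Type*) [CommRing k]

/-- The generic `2 × 2` matrix. -/
noncomputable def genericMatrix : Matrix (Fin 2) (Fin 2) (MvPolynomial (Fin 2 × Fin 2) k) :=
  Matrix.of fun i j => MvPolynomial.X (i, j)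

/-- The coordinate ring `k[SL₂] = k[x₀₀, x₀₁, x₁₀, x₁₁] / (det - 1)`. -/
def CoordRing : Type _ :=
  MvPolynomial (Fin 2 × Fin 2) k ⧸ Ideal.span {(genericMatrix k).det - 1}

noncomputable instance : CommRing (CoordRing k) :=
  inferInstanceAs (CommRing (_ ⧸ Ideal.span {(genericMatrix k).det - 1}))

noncomputable instance : Algebra k (CoordRing k) :=
  inferInstanceAs (Algebra k (_ ⧸ Ideal.span {(genericMatrix k).det - 1}))

/-- The quotient map `k[x₀₀, x₀₁, x₁₀, x₁₁] → k[SL₂]`. -/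
noncomputable def CoordRing.mk : MvPolynomial (Fin 2 × Fin 2) k →ₐ[k] CoordRing k :=
  Ideal.Quotient.mkₐ k (Ideal.span {(genericMatrix k).det - 1})

/-- The universal point of `SL₂`, with entries in `k[SL₂]`. -/
noncomputable def univ : Matrix.SpecialLinearGroup (Fin 2) (CoordRing k) :=
  ⟨(CoordRing.mk k).mapMatrix (genericMatrix k), by
    rw [← AlgHom.map_det, ← sub_eq_zero, ← map_one (CoordRing.mk k), ← map_sub]
    exact Ideal.Quotient.eq_zero_iff_mem.2 (Ideal.subset_span rfl)⟩

variable {k} {A : Type*} [CommRing A] [Algebra k A]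

/-- The homomorphism `k[SL₂] → A` corresponding to `g ∈ SL₂(A)`: it sends `xᵢⱼ` to `gᵢⱼ`. -/
noncomputable def point (g : Matrix.SpecialLinearGroup (Fin 2) A) : CoordRing k →ₐ[k] A :=
  Ideal.Quotient.liftₐ (Ideal.span {(genericMatrix k).det - 1})
    (MvPolynomial.aeval fun ij => g.1 ij.1 ij.2) (by
      intro a ha
      have hle : Ideal.span {(genericMatrix k).det - 1} ≤
          RingHom.ker (MvPolynomial.aeval (R := k) fun ij : Fin 2 × Fin 2 => g.1 ij.1 ij.2) := by
        rw [Ideal.span_le, Set.singleton_subset_iff]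
        have hg := g.2
        rw [Matrix.det_fin_two] at hg
        simp [RingHom.mem_ker, Matrix.det_fin_two, genericMatrix, hg]
      exact hle ha)

@[simp] theorem point_univ (g : Matrix.SpecialLinearGroup (Fin 2) A) (i j : Fin 2) :
    point (k := k) g ((univ k).1 i j) = g.1 i j := by
  change point (k := k) g (CoordRing.mk k (MvPolynomial.X (i, j))) = _
  exact (Ideal.Quotient.liftₐ_apply _ _ _ _).trans (by
    change MvPolynomial.aeval (R := k) (fun ij : Fin 2 × Fin 2 => g.1 ij.1 ij.2)
      (MvPolynomial.X (i, j)) = _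
    simp)

theorem CoordRing.algHom_ext {B : Type*} [Semiring B] [Algebra k B] {φ ψ : CoordRing k →ₐ[k] B}
    (h : ∀ i j, φ ((univ k).1 i j) = ψ ((univ k).1 i j)) : φ = ψ := by
  have : φ.comp (CoordRing.mk k) = ψ.comp (CoordRing.mk k) :=
    MvPolynomial.algHom_ext fun ij => h ij.1 ij.2
  ext x
  obtain ⟨y, rfl⟩ := Ideal.Quotient.mk_surjective x
  exact DFunLike.congr_fun this y

variable (k)

/-- The comultiplication `xᵢⱼ ↦ ∑ₗ xᵢₗ ⊗ xₗⱼ`. -/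
noncomputable def comulHom : CoordRing k →ₐ[k] CoordRing k ⊗[k] CoordRing k :=
  point ((univ k).map (Algebra.TensorProduct.includeLeft :
      CoordRing k →ₐ[k] CoordRing k ⊗[k] CoordRing k).toRingHom *
    (univ k).map (Algebra.TensorProduct.includeRight :
      CoordRing k →ₐ[k] CoordRing k ⊗[k] CoordRing k).toRingHom)

/-- The counit `xᵢⱼ ↦ δᵢⱼ`. -/
noncomputable def counitHom : CoordRing k →ₐ[k] k := point 1

theorem comulHom_univ (i j : Fin 2) :
    comulHom k ((univ k).1 i j) = ∑ l, (univ k).1 i l ⊗ₜ[k] (univ k).1 l j := by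
  rw [comulHom, point_univ]
  rw [Matrix.SpecialLinearGroup.coe_mul, Matrix.mul_apply]
  refine Finset.sum_congr rfl fun l _ => ?_
  change ((univ k).1 i l ⊗ₜ[k] 1) * (1 ⊗ₜ[k] (univ k).1 l j) = _
  simp

theorem counitHom_univ (i j : Fin 2) :
    counitHom k ((univ k).1 i j) = if i = j then 1 else 0 := by
  rw [counitHom, point_univ]
  simp [Matrix.one_apply]

noncomputable instance : Bialgebra k (CoordRing k) :=
  Bialgebra.ofAlgHom (comulHom k) (counitHom k)
    (CoordRing.algHom_ext fun i j => by
      simp [comulHom_univ, TensorProduct.add_tmul, TensorProduct.tmul_add]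
      abel)
    (CoordRing.algHom_ext fun i j => by
      fin_cases i <;> simp [comulHom_univ, counitHom_univ])
    (CoordRing.algHom_ext fun i j => by
      fin_cases j <;> simp [comulHom_univ, counitHom_univ])

theorem counitAlgHom_eq : Bialgebra.counitAlgHom k (CoordRing k) = counitHom k := rfl

end CoordRing

/-! ### Distributions on `SL₂` -/

section Elements

variable (k : Type*) [CommRing k]

/-- A formal curve `g ∈ SL₂(k⟦u⟧)` with `g(0) = 1` specialises to the counit. -/
theorem constantCoeff_point (g : Matrix.SpecialLinearGroup (Fin 2) (PowerSeries k))
    (hg : ∀ i j, PowerSeries.constantCoeff (g.1 i j) = if i = j then 1 else 0)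
    (f : CoordRing k) :
    PowerSeries.constantCoeff (point (k := k) g f) = Coalgebra.counit (R := k) f := by
  let c : PowerSeries k →ₐ[k] k := ⟨PowerSeries.constantCoeff, by
    intro r
    simp⟩
  have : c.comp (point g) = counitHom k := CoordRing.algHom_ext fun i j => by
    rw [AlgHom.comp_apply, point_univ, counitHom_univ]
    exact hg i j
  exact DFunLike.congr_fun this f

/-- The curve `u ↦ (1 u; 0 1)`. -/
noncomputable def upper : Matrix.SpecialLinearGroup (Fin 2) (PowerSeries k) :=
  ⟨!![1, PowerSeries.X; 0, 1], by simp [Matrix.det_fin_two]⟩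

/-- The curve `u ↦ (1 0; u 1)`. -/
noncomputable def lower : Matrix.SpecialLinearGroup (Fin 2) (PowerSeries k) :=
  ⟨!![1, 0; PowerSeries.X, 1], by simp [Matrix.det_fin_two]⟩

/-- The curve `u ↦ diag(1 + u, (1 + u)⁻¹)`, where `(1 + u)⁻¹ = ∑ (-1)ⁿ uⁿ`. -/
noncomputable def torus : Matrix.SpecialLinearGroup (Fin 2) (PowerSeries k) :=
  ⟨!![1 + PowerSeries.X, 0; 0, PowerSeries.mk fun n => (-1) ^ n], by
    rw [Matrix.det_fin_two]
    ext n
    cases n <;> simp [add_mul, PowerSeries.coeff_one, PowerSeries.coeff_succ_X_mul, pow_succ]⟩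

/-- The divided power `X^{(n)}`: the coefficient of `uⁿ` along `u ↦ (1 u; 0 1)`. -/
noncomputable def divX (n : ℕ) : DistAlg k (CoordRing k) :=
  DistAlg.ofCurve (point (upper k)) (constantCoeff_point k _ fun i j => by
    fin_cases i <;> fin_cases j <;> simp [upper]) n

/-- The divided power `Y^{(n)}`: the coefficient of `uⁿ` along `u ↦ (1 0; u 1)`. -/
noncomputable def divY (n : ℕ) : DistAlg k (CoordRing k) :=
  DistAlg.ofCurve (point (lower k)) (constantCoeff_point k _ fun i j => by
    fin_cases i <;> fin_cases j <;> simp [lower]) n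

/-- `binom(H, n)`: the coefficient of `uⁿ` along `u ↦ diag(1 + u, (1 + u)⁻¹)`, that is, the
distribution on the torus `{diag(s, s⁻¹)}` dual to `(s - 1)ⁿ`. -/
noncomputable def binomH (n : ℕ) : DistAlg k (CoordRing k) :=
  DistAlg.ofCurve (point (torus k)) (constantCoeff_point k _ fun i j => by
    fin_cases i <;> fin_cases j <;> simp [torus]) n

/-- `binom(H + m, n) = ∑_{i + j = n} binom(m, i) binom(H, j)` for `m ∈ ℤ`. -/
noncomputable def binomHAdd (m : ℤ) (n : ℕ) : DistAlg k (CoordRing k) :=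
  ∑ ij ∈ Finset.HasAntidiagonal.antidiagonal n, ((Ring.choose m ij.1 : ℤ) : k) • binomH k ij.2

end Elements

/-! ### The modular theory: `k = 𝔽_p` -/

section Modular

variable (p : ℕ) [Fact p.Prime]

/-- `Dist(SL₂)` over the prime field `𝔽_p`. -/
abbrev DistSL : Type := DistAlg (ZMod p) (CoordRing (ZMod p))

/-- `μ_n^{(r)} = ∑_{i < p^r} (-1)^i binom(H - n, i)`. -/
noncomputable def mu (r : ℕ) (n : ℤ) : DistSL p :=
  ∑ i ∈ Finset.range (p ^ r), (-1 : ZMod p) ^ i • binomHAdd (ZMod p) (-n) i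

/-- `Dist(Fr)`, induced by the Frobenius endomorphism of `SL₂` over `𝔽_p`, whose comorphism is
`f ↦ f ^ p` on `𝔽_p[SL₂]`. -/
noncomputable def distFr : DistSL p →ₗ[ZMod p] DistSL p :=
  DistAlg.comap (FiniteField.frobeniusAlgHom (ZMod p) (CoordRing (ZMod p))) (by
    ext f
    simp)

/-- `F` is the linear extension to `Dist(SL₂)` of `binom(H, m) ↦ binom(H, pm)` characterised by
`X^{(a)} μ_n^{(1+b)} Y^{(c)} ↦ X^{(pa)} F(μ_n^{(1+b)}) Y^{(pc)}`. -/
def IsFrPrime (F : DistSL p →ₗ[ZMod p] DistSL p) : Prop :=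
  (∀ m : ℕ, F (binomH (ZMod p) m) = binomH (ZMod p) (p * m)) ∧
  ∀ (a b c : ℕ) (n : ℤ),
    F (divX (ZMod p) a * mu p (1 + b) n * divY (ZMod p) c) =
      divX (ZMod p) (p * a) * F (mu p (1 + b) n) * divY (ZMod p) (p * c)

/-- The `𝔽_p`-span of the `X^{(pa)} Y^{(pc)} μ_{np}^{(1+b)}`, for `a, b, c ∈ ℕ` and
`0 ≤ n < p^b`. -/
noncomputable def spanFr : Submodule (ZMod p) (DistSL p) :=
  Submodule.span (ZMod p)
    {x | ∃ a b c n : ℕ, n < p ^ b ∧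
      x = divX (ZMod p) (p * a) * divY (ZMod p) (p * c) * mu p (1 + b) ((n * p : ℕ) : ℤ)}

end Modular

end SLTwo

/-!
The proof rests on a description of `Dist(SL₂)` by the values of a distribution on the monomials
`x₀₁ ^ i * x₁₀ ^ j * x₁₁ ^ l`. Near the neutral element `x₁₁` is invertible, and modulo each power
of the augmentation ideal its inverse is a polynomial in `x₁₁`; since `x₀₀ x₁₁ = 1 + x₀₁ x₁₀`,
a distribution is determined by these values (`ext_monomial`). Multiplying by a coefficient of a
formal curve amounts to translating the function along the curve (`DistAlg.ev_ofCurve_mul`), which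
gives closed formulas: a distribution on the torus, seen as a function `h` on the weight lattice
`ℤ`, multiplies the value at `(i, j, l)` by `h(i - j - l)` on the left and by `h(j - i - l)` on the
right, and `X^{(a)} h Y^{(c)}` takes the value `h(-(a + c + l))` if `(i, j) = (a, c)` and `0`
otherwise. Here `binom(H, m)` is the function `z ↦ binom(z, m)` and `μ_n^{(r)}` is the indicator
function of `n + p ^ r ℤ`.

In characteristic `p` the value at `(i, j, l)` is periodic in `l` with period a power of `p`
(`exists_periodic`). Hence every distribution is a finite combination of products
`X^{(a)} μ_n^{(1+b)} Y^{(c)}`, and the products `X^{(a)} binom(H, m) Y^{(c)}` form a basis; this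
gives the existence and the uniqueness of `Fr'`.

Frobenius acts on values by `(i, j, l) ↦ (pi, pj, pl)`. Let `S` be the space of distributions that
vanish on all monomials that are not `p`-th powers (`powSupported`). It is the span of the
`X^{(pa)} Y^{(pc)} μ_{np}^{(1+b)}` (`spanFr_eq_powSupported`), and `Dist(Fr)` is visibly injective
on it. By Lucas' congruence `binom(pz, pm) ≡ binom(z, m)`, the map `φ(μ) = Fr'(μ) μ₀` takes values
in `S` and satisfies `Dist(Fr) ∘ φ = id`, so `φ` and `Dist(Fr)` are inverse bijections between
`Dist(SL₂)` and `S`. Since `Dist(Fr)` is multiplicative, `φ` is multiplicative as soon as `S` is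
closed under multiplication. The only case that is not immediate is left multiplication by
`Y^{(pc)}`; it replaces the usual commutation formula for divided powers and follows from an
explicit expansion of the translated monomial (`leftTranslate_lower_monomial`) and Lucas' theorem
(`divY_mul_mem_powSupported`).
-/

/-! ### Binomial coefficients modulo `p` -/

namespace SLTwo

section Binomials

variable (p : ℕ) [Fact p.Prime]

/-- `(1 + u) ^ (z + p ^ N) = (1 + u) ^ z * (1 + u ^ (p ^ N))` in characteristic `p`. -/
theorem choose_periodic {m N : ℕ} (hm : m < p ^ N) :
    Function.Periodic (fun z : ℤ => ((Ring.choose z m : ℤ) : ZMod p)) ((p ^ N : ℕ) : ℤ) := by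
  intro z
  have : CharP (PowerSeries (ZMod p)) p :=
    charP_of_injective_ringHom PowerSeries.C_injective p
  have h := PowerSeries.binomialSeries_add (A := ZMod p) z ((p ^ N : ℕ) : ℤ)
  rw [PowerSeries.binomialSeries_nat, add_pow_char_pow, one_pow, mul_add, mul_one] at h
  have := congrArg (PowerSeries.coeff m) h
  rw [map_add, PowerSeries.coeff_mul_X_pow', if_neg (by omega)] at this
  rw [PowerSeries.binomialSeries_coeff, add_zero, PowerSeries.binomialSeries_coeff] at this
  simpa using this

theorem choose_eq_of_modEq {m N : ℕ} (hm : m < p ^ N) {z w : ℤ}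
    (h : z ≡ w [ZMOD (p ^ N : ℕ)]) :
    ((Ring.choose z m : ℤ) : ZMod p) = ((Ring.choose w m : ℤ) : ZMod p) := by
  obtain ⟨y, hy⟩ := h.dvd
  have := ((choose_periodic p hm).int_mul y) z
  rw [show w = z + y * ((p ^ N : ℕ) : ℤ) by linarith]
  exact this.symm

theorem exists_nat_modEq (N : ℕ) (z : ℤ) : ∃ r : ℕ, r < p ^ N ∧ z ≡ r [ZMOD (p ^ N : ℕ)] := by
  have hpos : (0 : ℤ) < (p ^ N : ℕ) := by
    exact_mod_cast pow_pos (Fact.out : p.Prime).pos N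
  refine ⟨(z % (p ^ N : ℕ)).toNat, ?_, ?_⟩
  · have := Int.emod_lt_of_pos z hpos
    have := Int.emod_nonneg z hpos.ne'
    omega
  · rw [Int.toNat_of_nonneg (Int.emod_nonneg z hpos.ne')]
    exact (Int.mod_modEq _ _).symm

/-- The case of Lucas' theorem in which the last base `p` digits vanish, for an integral top. -/
theorem choose_prime_mul (z : ℤ) (m : ℕ) :
    ((Ring.choose (p * z) (p * m) : ℤ) : ZMod p) = ((Ring.choose z m : ℤ) : ZMod p) := by
  have hp : p.Prime := Fact.out
  have hm : m < p ^ m := Nat.lt_pow_self hp.one_lt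
  obtain ⟨r, -, hr⟩ := exists_nat_modEq p m z
  have hr' : p * z ≡ ((p * r : ℕ) : ℤ) [ZMOD (p ^ (m + 1) : ℕ)] := by
    have := hr.mul_left' (c := (p : ℤ))
    rw [pow_succ']
    push_cast at this ⊢
    exact this
  rw [choose_eq_of_modEq p hm hr, choose_eq_of_modEq p (N := m + 1)
    (by rw [pow_succ']; exact Nat.mul_lt_mul_of_pos_left hm hp.pos) hr', Ring.choose_natCast,
    Ring.choose_natCast, Int.cast_natCast, Int.cast_natCast, ZMod.natCast_eq_natCast_iff]
  have := Choose.choose_modEq_choose_mod_mul_choose_div_nat (n := p * r) (k := p * m) (p := p)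
  simpa [Nat.mul_div_cancel_left _ hp.pos] using this

theorem dvd_of_choose_ne_zero {n m : ℕ} (hn : p ∣ n) (h : (n.choose m : ZMod p) ≠ 0) : p ∣ m := by
  have hp : p.Prime := Fact.out
  by_contra hm
  apply h
  rw [ZMod.natCast_eq_zero_iff]
  have := Choose.choose_modEq_choose_mod_mul_choose_div_nat (n := n) (k := m) (p := p)
  rw [Nat.mod_eq_zero_of_dvd hn, Nat.choose_eq_zero_of_lt
    (Nat.pos_of_ne_zero fun h0 => hm (Nat.dvd_of_mod_eq_zero h0)), zero_mul] at this
  exact (Nat.modEq_zero_iff_dvd).1 this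

/-- The truncated alternating sum of binomial coefficients is, modulo `p`, the indicator
function of `p ^ r ℤ`. -/
theorem sum_neg_one_pow_choose (r : ℕ) (z : ℤ) :
    ∑ i ∈ Finset.range (p ^ r), (-1 : ZMod p) ^ i * ((Ring.choose z i : ℤ) : ZMod p) =
      if ((p ^ r : ℕ) : ℤ) ∣ z then 1 else 0 := by
  obtain ⟨n, hn, hz⟩ := exists_nat_modEq p r z
  have h1 : ∀ i ∈ Finset.range (p ^ r), (-1 : ZMod p) ^ i * ((Ring.choose z i : ℤ) : ZMod p) =
      (-1 : ZMod p) ^ i * (n.choose i : ZMod p) := by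
    intro i hi
    rw [choose_eq_of_modEq p (Finset.mem_range.1 hi) hz, Ring.choose_natCast, Int.cast_natCast]
  have h2 : ((p ^ r : ℕ) : ℤ) ∣ z ↔ n = 0 := by
    rw [hz.dvd_iff, Int.natCast_dvd_natCast]
    exact ⟨fun h => Nat.eq_zero_of_dvd_of_lt h hn, fun h => h ▸ dvd_zero _⟩
  rw [Finset.sum_congr rfl h1, ← Finset.sum_subset
    (Finset.range_subset_range.2 (Nat.succ_le_of_lt hn))]
  · have := congrArg (Int.cast : ℤ → ZMod p) (Int.alternating_sum_range_choose (n := n))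
    push_cast at this
    rw [this]
    simp only [h2]
  · intro i _ hi
    rw [Nat.choose_eq_zero_of_lt (by simpa using hi)]
    simp

end Binomials

end SLTwo

/-! ### Convolution with a formal curve -/

section Translation

variable {k A : Type*} [CommRing k] [CommRing A] [Bialgebra k A]

/-- Evaluation of distributions at a function. -/
def DistAlg.ev (f : A) : DistAlg k A →ₗ[k] k where
  toFun μ := μ.1.ofConv f
  map_add' _ _ := rfl
  map_smul' _ _ := rfl

theorem DistAlg.ev_add (f g : A) (μ : DistAlg k A) :
    DistAlg.ev (f + g) μ = DistAlg.ev f μ + DistAlg.ev g μ := map_add μ.1.ofConv f g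

theorem DistAlg.ev_zero (μ : DistAlg k A) : DistAlg.ev 0 μ = 0 := map_zero μ.1.ofConv

theorem DistAlg.ev_sub (f : A) (μ ν : DistAlg k A) :
    DistAlg.ev f (μ - ν) = DistAlg.ev f μ - DistAlg.ev f ν := map_sub (DistAlg.ev f) μ ν

theorem DistAlg.ev_sum {ι : Type*} (s : Finset ι) (f : ι → A) (μ : DistAlg k A) :
    DistAlg.ev (∑ i ∈ s, f i) μ = ∑ i ∈ s, DistAlg.ev (f i) μ := map_sum μ.1.ofConv f s

theorem DistAlg.ev_smul (c : k) (f : A) (μ : DistAlg k A) :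
    DistAlg.ev (c • f) μ = c * DistAlg.ev f μ := map_smul μ.1.ofConv c f

theorem DistAlg.ext_ev {μ ν : DistAlg k A} (h : ∀ f, DistAlg.ev f μ = DistAlg.ev f ν) : μ = ν := by
  apply Subtype.ext
  apply WithConv.ofConv_injective
  exact LinearMap.ext h

theorem DistAlg.ev_one (f : A) : DistAlg.ev f (1 : DistAlg k A) = Coalgebra.counit (R := k) f := by
  change (1 : WithConv (A →ₗ[k] k)) f = _
  rw [LinearMap.convOne_apply]
  simp

theorem DistAlg.ev_ofCurve (γ : A →ₐ[k] PowerSeries k) (hγ) (n : ℕ) (f : A) :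
    DistAlg.ev f (DistAlg.ofCurve γ hγ n) = PowerSeries.coeff n (γ f) := rfl

theorem DistAlg.ev_mul (f : A) (μ ν : DistAlg k A) :
    DistAlg.ev f (μ * ν) = LinearMap.mul' k k
      (TensorProduct.map μ.1.ofConv ν.1.ofConv (Coalgebra.comul (R := k) f)) := rfl

/-- The translate of `f` by a curve acting from the left: the image of `Δ f` under
`k[G] ⊗ k[G] → k[G]⟦u⟧`, `x ⊗ y ↦ γ(x) y`. -/
noncomputable def leftTranslate (γ : A →ₐ[k] PowerSeries k) : A →ₐ[k] PowerSeries A :=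
  (Algebra.TensorProduct.lift ((PowerSeries.mapAlgHom (Algebra.ofId k A)).comp γ)
    (Algebra.algHom k A (PowerSeries A)) fun _ _ => Commute.all _ _).comp
      (Bialgebra.comulAlgHom k A)

/-- The translate of `f` by a curve acting from the right. -/
noncomputable def rightTranslate (γ : A →ₐ[k] PowerSeries k) : A →ₐ[k] PowerSeries A :=
  (Algebra.TensorProduct.lift (Algebra.algHom k A (PowerSeries A))
    ((PowerSeries.mapAlgHom (Algebra.ofId k A)).comp γ) fun _ _ => Commute.all _ _).comp
      (Bialgebra.comulAlgHom k A)

theorem DistAlg.ev_ofCurve_mul (γ : A →ₐ[k] PowerSeries k) (hγ) (n : ℕ) (ν : DistAlg k A)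
    (f : A) : DistAlg.ev f (DistAlg.ofCurve γ hγ n * ν) =
      DistAlg.ev (PowerSeries.coeff n (leftTranslate γ f)) ν := by
  rw [DistAlg.ev_mul]
  change _ = DistAlg.ev (PowerSeries.coeff n (Algebra.TensorProduct.lift _ _
    (fun _ _ => Commute.all _ _) (Coalgebra.comul (R := k) f))) ν
  induction Coalgebra.comul (R := k) f with
  | zero => simp [DistAlg.ev_zero]
  | add x y hx hy => simp only [map_add, hx, hy, DistAlg.ev_add]
  | tmul x y =>
    rw [Algebra.TensorProduct.lift_tmul]
    change PowerSeries.coeff n (γ x) * DistAlg.ev y ν = DistAlg.ev (PowerSeries.coeff n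
      (PowerSeries.map (algebraMap k A) (γ x) * PowerSeries.C y)) ν
    rw [PowerSeries.coeff_mul_C, PowerSeries.coeff_map, ← Algebra.smul_def]
    exact ((ν.1.ofConv).map_smul _ _).symm

theorem DistAlg.ev_mul_ofCurve (γ : A →ₐ[k] PowerSeries k) (hγ) (n : ℕ) (ν : DistAlg k A)
    (f : A) : DistAlg.ev f (ν * DistAlg.ofCurve γ hγ n) =
      DistAlg.ev (PowerSeries.coeff n (rightTranslate γ f)) ν := by
  rw [DistAlg.ev_mul]
  change _ = DistAlg.ev (PowerSeries.coeff n (Algebra.TensorProduct.lift _ _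
    (fun _ _ => Commute.all _ _) (Coalgebra.comul (R := k) f))) ν
  induction Coalgebra.comul (R := k) f with
  | zero => simp [DistAlg.ev_zero]
  | add x y hx hy => simp only [map_add, hx, hy, DistAlg.ev_add]
  | tmul x y =>
    rw [Algebra.TensorProduct.lift_tmul]
    change DistAlg.ev x ν * PowerSeries.coeff n (γ y) = DistAlg.ev (PowerSeries.coeff n
      (PowerSeries.C x * PowerSeries.map (algebraMap k A) (γ y))) ν
    rw [PowerSeries.coeff_C_mul, PowerSeries.coeff_map, mul_comm, mul_comm x, ← Algebra.smul_def]
    exact ((ν.1.ofConv).map_smul _ _).symm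

/-- Pulling back along a homomorphism of affine groups is multiplicative. -/
theorem DistAlg.comap_mul {B : Type*} [CommRing B] [Bialgebra k B] (θ : B →ₐ[k] A)
    (hθ : (Bialgebra.counitAlgHom k A).comp θ = Bialgebra.counitAlgHom k B)
    (hΔ : (Bialgebra.comulAlgHom k A).comp θ =
      (Algebra.TensorProduct.map θ θ).comp (Bialgebra.comulAlgHom k B)) (μ ν : DistAlg k A) :
    DistAlg.comap θ hθ (μ * ν) = DistAlg.comap θ hθ μ * DistAlg.comap θ hθ ν := by
  refine DistAlg.ext_ev fun f => ?_
  rw [DistAlg.ev_mul]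
  change LinearMap.mul' k k (TensorProduct.map μ.1.ofConv ν.1.ofConv
    ((Bialgebra.comulAlgHom k A).comp θ f)) = _
  rw [hΔ]
  change LinearMap.mul' k k (TensorProduct.map μ.1.ofConv ν.1.ofConv
    (Algebra.TensorProduct.map θ θ (Coalgebra.comul (R := k) f))) = _
  induction Coalgebra.comul (R := k) f with
  | zero => simp
  | add x y hx hy => simp only [map_add, hx, hy]
  | tmul x y => rfl

end Translation

/-! ### Monomials on the open cell -/

namespace SLTwo

section Cell

variable (k : Type*) [CommRing k]

theorem leftTranslate_point (g : Matrix.SpecialLinearGroup (Fin 2) (PowerSeries k)) (i j : Fin 2) :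
    leftTranslate (point (k := k) g) ((univ k).1 i j) =
      ∑ l, PowerSeries.map (algebraMap k (CoordRing k)) (g.1 i l) *
        PowerSeries.C ((univ k).1 l j) := by
  change Algebra.TensorProduct.lift _ _ (fun _ _ => Commute.all _ _)
    (comulHom k ((univ k).1 i j)) = _
  rw [comulHom_univ, map_sum]
  refine Finset.sum_congr rfl fun l _ => ?_
  rw [Algebra.TensorProduct.lift_tmul, AlgHom.comp_apply, point_univ]
  rfl

theorem rightTranslate_point (g : Matrix.SpecialLinearGroup (Fin 2) (PowerSeries k))
    (i j : Fin 2) : rightTranslate (point (k := k) g) ((univ k).1 i j) =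
      ∑ l, PowerSeries.C ((univ k).1 i l) *
        PowerSeries.map (algebraMap k (CoordRing k)) (g.1 l j) := by
  change Algebra.TensorProduct.lift _ _ (fun _ _ => Commute.all _ _)
    (comulHom k ((univ k).1 i j)) = _
  rw [comulHom_univ, map_sum]
  refine Finset.sum_congr rfl fun l _ => ?_
  rw [Algebra.TensorProduct.lift_tmul, AlgHom.comp_apply, point_univ]
  rfl

/-- The function `x₀₁ ^ i * x₁₀ ^ j * x₁₁ ^ l` on `SL₂`. -/
noncomputable def monomial (i j l : ℕ) : CoordRing k :=
  (univ k).1 0 1 ^ i * (univ k).1 1 0 ^ j * (univ k).1 1 1 ^ l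

theorem univ_det : (univ k).1 0 0 * (univ k).1 1 1 =
    1 + (univ k).1 0 1 * (univ k).1 1 0 := by
  have := (univ k).2
  rw [Matrix.det_fin_two] at this
  linear_combination this

theorem univ_sub_mem_augIdeal (i j : Fin 2) :
    (univ k).1 i j - (if i = j then 1 else 0) ∈ augIdeal k (CoordRing k) := by
  change counitHom k _ = 0
  rw [map_sub, counitHom_univ]
  split_ifs <;> simp

theorem adjoin_univ :
    Algebra.adjoin k {x | ∃ i j, x = (univ k).1 i j} = (⊤ : Subalgebra k (CoordRing k)) := by
  rw [eq_top_iff]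
  intro x _
  obtain ⟨y, rfl⟩ : ∃ y, CoordRing.mk k y = x := Ideal.Quotient.mk_surjective x
  induction y using MvPolynomial.induction_on with
  | C r => exact (Algebra.adjoin k _).algebraMap_mem r
  | add f g hf hg => rw [map_add]; exact add_mem (hf trivial) (hg trivial)
  | mul_X f ij hf =>
    rw [map_mul]
    exact mul_mem (hf trivial) (Algebra.subset_adjoin ⟨ij.1, ij.2, rfl⟩)

/-- Modulo a power of the augmentation ideal, `x₁₁` is invertible, with inverse a polynomial in
`x₁₁`, so every function is congruent to a polynomial in `x₀₁`, `x₁₀`, `x₁₁`. -/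
theorem exists_mvPolynomial_sub_mem (n : ℕ) (f : CoordRing k) :
    ∃ q : MvPolynomial (Fin 3) k, f - MvPolynomial.aeval
      ![(univ k).1 0 1, (univ k).1 1 0, (univ k).1 1 1] q ∈ augIdeal k (CoordRing k) ^ n := by
  set I := augIdeal k (CoordRing k) ^ n
  set θ := MvPolynomial.aeval (R := k) ![(univ k).1 0 1, (univ k).1 1 0, (univ k).1 1 1] with hθ
  have hf : f ∈ Algebra.adjoin k {x | ∃ i j, x = (univ k).1 i j} := by
    rw [adjoin_univ]; trivial
  have hX : ∀ l : Fin 3, ∃ q, ![(univ k).1 0 1, (univ k).1 1 0, (univ k).1 1 1] l - θ q ∈ I :=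
    fun l => ⟨MvPolynomial.X l, by rw [hθ, MvPolynomial.aeval_X, sub_self]; exact I.zero_mem⟩
  induction hf using Algebra.adjoin_induction with
  | algebraMap r => exact ⟨MvPolynomial.C r, by simp⟩
  | add x y _ _ hx hy =>
    obtain ⟨q, hq⟩ := hx
    obtain ⟨r, hr⟩ := hy
    refine ⟨q + r, ?_⟩
    rw [map_add, add_sub_add_comm]
    exact I.add_mem hq hr
  | mul x y _ _ hx hy =>
    obtain ⟨q, hq⟩ := hx
    obtain ⟨r, hr⟩ := hy
    refine ⟨q * r, ?_⟩
    rw [map_mul, show x * y - θ q * θ r = y * (x - θ q) + θ q * (y - θ r) by ring]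
    exact I.add_mem (I.mul_mem_left _ hq) (I.mul_mem_left _ hr)
  | mem x hx =>
    obtain ⟨i, j, rfl⟩ := hx
    fin_cases i <;> fin_cases j
    -- `x₀₀ = (1 + x₀₁ x₁₀) / x₁₁`, and `1 / x₁₁` is replaced by a truncated geometric series.
    · refine ⟨(1 + MvPolynomial.X 0 * MvPolynomial.X 1) *
        ∑ m ∈ Finset.range n, (1 - MvPolynomial.X 2) ^ m, ?_⟩
      have hgeom := mul_neg_geom_sum (1 - (univ k).1 1 1) n
      have : (univ k).1 0 0 - (1 + (univ k).1 0 1 * (univ k).1 1 0) *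
          ∑ m ∈ Finset.range n, (1 - (univ k).1 1 1) ^ m =
          (univ k).1 0 0 * (1 - (univ k).1 1 1) ^ n := by
        rw [← univ_det]
        linear_combination -(univ k).1 0 0 * hgeom
      have h2 : 1 - (univ k).1 1 1 ∈ augIdeal k (CoordRing k) := by
        rw [← neg_mem_iff, neg_sub]
        exact univ_sub_mem_augIdeal k 1 1
      simpa [hθ, this] using I.mul_mem_left _ (Ideal.pow_mem_pow h2 n)
    · exact hX 0
    · exact hX 1
    · exact hX 2

variable {k}

/-- A distribution is determined by its values on the polynomials in `x₀₁`, `x₁₀`, `x₁₁`. -/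
theorem ext_monomial {μ ν : DistAlg k (CoordRing k)}
    (h : ∀ i j l, DistAlg.ev (monomial k i j l) μ = DistAlg.ev (monomial k i j l) ν) : μ = ν := by
  refine DistAlg.ext_ev fun f => ?_
  obtain ⟨n, hn⟩ := (μ - ν).2
  obtain ⟨q, hq⟩ := exists_mvPolynomial_sub_mem k n f
  set θ := MvPolynomial.aeval (R := k) ![(univ k).1 0 1, (univ k).1 1 0, (univ k).1 1 1]
  have h0 : ∀ q, DistAlg.ev (θ q) (μ - ν) = 0 := by
    have : (μ - ν).1.ofConv ∘ₗ θ.toLinearMap = 0 := by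
      refine MvPolynomial.linearMap_ext fun s => LinearMap.ext_ring ?_
      have hs : θ (MvPolynomial.monomial s 1) = monomial k (s 0) (s 1) (s 2) := by
        simp [θ, MvPolynomial.aeval_monomial, Finsupp.prod_fintype, Fin.prod_univ_three, monomial]
      change DistAlg.ev (θ (MvPolynomial.monomial s 1)) (μ - ν) = 0
      rw [hs, DistAlg.ev_sub, h, sub_self]
    exact fun q => LinearMap.congr_fun this q
  have h1 : DistAlg.ev (f - θ q) (μ - ν) = 0 := hn _ hq
  rw [← sub_eq_zero, ← DistAlg.ev_sub, ← sub_add_cancel f (θ q), DistAlg.ev_add, h1, h0, add_zero]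

end Cell

end SLTwo

/-! ### The action of the standard distributions on monomials -/

namespace SLTwo

section Action

variable (k : Type*) [CommRing k]

theorem binomialSeries_pow (z : ℤ) (n : ℕ) :
    PowerSeries.binomialSeries k z ^ n = PowerSeries.binomialSeries k (n * z) := by
  induction n with
  | zero => simp
  | succ n ih =>
    rw [pow_succ, ih, ← PowerSeries.binomialSeries_add]
    congr 1
    push_cast
    ring

theorem coeff_binomialSeries (z : ℤ) (n : ℕ) :
    PowerSeries.coeff n (PowerSeries.binomialSeries k z) = ((Ring.choose z n : ℤ) : k) := by
  rw [PowerSeries.binomialSeries_coeff, zsmul_one]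

theorem one_add_X_eq : (1 + PowerSeries.X : PowerSeries k) =
    PowerSeries.binomialSeries k (1 : ℤ) := by
  have := PowerSeries.binomialSeries_nat (R := ℤ) (A := k) 1
  rw [Nat.cast_one, pow_one] at this
  exact this.symm

theorem mk_neg_one_pow_eq : (PowerSeries.mk fun n => (-1 : k) ^ n) =
    PowerSeries.binomialSeries k (-1 : ℤ) := by
  have h := (torus k).2
  simp only [torus, Matrix.det_fin_two_of, mul_zero, sub_zero] at h
  refine (left_inv_eq_right_inv (a := 1 + PowerSeries.X) ?_ h).symm
  rw [one_add_X_eq, ← PowerSeries.binomialSeries_add, neg_add_cancel,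
    PowerSeries.binomialSeries_zero]

variable {k}

/-- Left multiplication by a distribution on the torus multiplies the value on each monomial by
the value at the weight of the monomial. -/
theorem ev_binomH_mul (m i j l : ℕ) (ν : DistAlg k (CoordRing k)) :
    DistAlg.ev (monomial k i j l) (binomH k m * ν) =
      ((Ring.choose (i - j - l : ℤ) m : ℤ) : k) * DistAlg.ev (monomial k i j l) ν := by
  rw [binomH, DistAlg.ev_ofCurve_mul, ← DistAlg.ev_smul]
  congr 1
  have h : leftTranslate (point (torus k)) (monomial k i j l) =
      PowerSeries.map (algebraMap k (CoordRing k))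
        (PowerSeries.binomialSeries k (i - j - l : ℤ)) * PowerSeries.C (monomial k i j l) := by
    rw [show (i - j - l : ℤ) = i * 1 + j * (-1) + l * (-1) by ring,
      PowerSeries.binomialSeries_add, PowerSeries.binomialSeries_add, ← binomialSeries_pow,
      ← binomialSeries_pow, ← binomialSeries_pow, ← one_add_X_eq, ← mk_neg_one_pow_eq]
    simp only [monomial, map_mul, map_pow, leftTranslate_point, Fin.sum_univ_two]
    simp only [torus, Matrix.of_apply, Matrix.cons_val', Matrix.cons_val_zero,
      Matrix.cons_val_one, map_zero, zero_mul, zero_add, add_zero, mul_pow]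
    ring
  rw [h, PowerSeries.coeff_mul_C, PowerSeries.coeff_map, coeff_binomialSeries, Algebra.smul_def]

theorem ev_mul_binomH (m i j l : ℕ) (ν : DistAlg k (CoordRing k)) :
    DistAlg.ev (monomial k i j l) (ν * binomH k m) =
      ((Ring.choose (j - i - l : ℤ) m : ℤ) : k) * DistAlg.ev (monomial k i j l) ν := by
  rw [binomH, DistAlg.ev_mul_ofCurve, ← DistAlg.ev_smul]
  congr 1
  have h : rightTranslate (point (torus k)) (monomial k i j l) =
      PowerSeries.map (algebraMap k (CoordRing k))
        (PowerSeries.binomialSeries k (j - i - l : ℤ)) * PowerSeries.C (monomial k i j l) := by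
    rw [show (j - i - l : ℤ) = j * 1 + i * (-1) + l * (-1) by ring,
      PowerSeries.binomialSeries_add, PowerSeries.binomialSeries_add, ← binomialSeries_pow,
      ← binomialSeries_pow, ← binomialSeries_pow, ← one_add_X_eq, ← mk_neg_one_pow_eq]
    simp only [monomial, map_mul, map_pow, rightTranslate_point, Fin.sum_univ_two]
    simp only [torus, Matrix.of_apply, Matrix.cons_val', Matrix.cons_val_zero,
      Matrix.cons_val_one, map_zero, mul_zero, zero_add, add_zero, mul_pow]
    ring
  rw [h, PowerSeries.coeff_mul_C, PowerSeries.coeff_map, coeff_binomialSeries, Algebra.smul_def]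

theorem ev_divX_mul (a i j l : ℕ) (ν : DistAlg k (CoordRing k)) :
    DistAlg.ev (monomial k i j l) (divX k a * ν) =
      (i.choose a : k) * DistAlg.ev (monomial k (i - a) j (l + a)) ν := by
  rw [divX, DistAlg.ev_ofCurve_mul, ← DistAlg.ev_smul]
  congr 1
  have h : leftTranslate (point (upper k)) (monomial k i j l) =
      ∑ m ∈ Finset.range (i + 1), PowerSeries.X ^ m *
        PowerSeries.C ((i.choose m : k) • monomial k (i - m) j (l + m)) := by
    simp only [monomial, map_mul, map_pow, leftTranslate_point, Fin.sum_univ_two]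
    simp only [upper, Matrix.of_apply, Matrix.cons_val', Matrix.cons_val_zero,
      Matrix.cons_val_one, map_zero, map_one, one_mul, zero_mul, zero_add, PowerSeries.map_X]
    rw [add_comm, add_pow, Finset.sum_mul, Finset.sum_mul]
    refine Finset.sum_congr rfl fun m _ => ?_
    rw [Algebra.smul_def, map_natCast, map_mul, map_natCast]
    simp only [map_mul, map_pow, mul_pow]
    ring
  rw [h, map_sum]
  simp only [PowerSeries.coeff_X_pow_mul', PowerSeries.coeff_C, Nat.sub_eq_zero_iff_le]
  by_cases hi : a ≤ i
  · rw [Finset.sum_eq_single a]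
    · simp
    · intro m _ hm
      split_ifs <;> first | rfl | omega
    · intro ha
      exact absurd (Finset.mem_range.2 (by omega)) ha
  · rw [Nat.choose_eq_zero_of_lt (by omega), Nat.cast_zero, zero_smul]
    refine congrArg _ (Finset.sum_eq_zero fun m hm => ?_)
    have := Finset.mem_range.1 hm
    split_ifs <;> first | rfl | omega

theorem ev_divY (c i j l : ℕ) :
    DistAlg.ev (monomial k i j l) (divY k c) = if i = 0 ∧ j = c then 1 else 0 := by
  rw [divY, DistAlg.ev_ofCurve]
  simp only [monomial, map_mul, map_pow, point_univ]
  simp only [lower, Matrix.of_apply, Matrix.cons_val', Matrix.cons_val_zero,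
    Matrix.cons_val_one, one_pow, mul_one]
  rcases Nat.eq_zero_or_pos i with rfl | hi
  · simp [PowerSeries.coeff_X_pow, eq_comm]
  · simp [hi.ne']

theorem divX_zero : divX k 0 = 1 := by
  refine DistAlg.ext_ev fun f => ?_
  rw [DistAlg.ev_one, divX, DistAlg.ev_ofCurve, PowerSeries.coeff_zero_eq_constantCoeff_apply]
  exact constantCoeff_point k _ (fun i j => by fin_cases i <;> fin_cases j <;> simp [upper]) f

theorem divY_zero : divY k 0 = 1 := by
  refine DistAlg.ext_ev fun f => ?_
  rw [DistAlg.ev_one, divY, DistAlg.ev_ofCurve, PowerSeries.coeff_zero_eq_constantCoeff_apply]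
  exact constantCoeff_point k _ (fun i j => by fin_cases i <;> fin_cases j <;> simp [lower]) f

theorem binomH_zero : binomH k 0 = 1 := by
  refine DistAlg.ext_ev fun f => ?_
  rw [DistAlg.ev_one, binomH, DistAlg.ev_ofCurve, PowerSeries.coeff_zero_eq_constantCoeff_apply]
  exact constantCoeff_point k _ (fun i j => by fin_cases i <;> fin_cases j <;> simp [torus]) f

/-- The values of the Poincaré–Birkhoff–Witt monomials. -/
theorem ev_pbw (a m c i j l : ℕ) :
    DistAlg.ev (monomial k i j l) (divX k a * binomH k m * divY k c) =
      if i = a ∧ j = c then ((Ring.choose (-(a + c + l) : ℤ) m : ℤ) : k) else 0 := by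
  rw [mul_assoc, ev_divX_mul, ev_binomH_mul, ev_divY]
  rcases lt_trichotomy i a with h | rfl | h
  · rw [Nat.choose_eq_zero_of_lt h, if_neg (c := i = a ∧ _) (fun h' => h.ne h'.1)]
    simp
  · by_cases hj : j = c
    · subst hj
      simp only [Nat.choose_self, Nat.sub_self, and_self, if_true]
      rw [show (((0 : ℕ) : ℤ) - j - (l + i : ℕ)) = -(i + j + l) by push_cast; ring]
      simp
    · simp [hj]
  · rw [if_neg (c := i = a ∧ _) (by omega), if_neg (c := i - a = 0 ∧ _) (by omega)]
    simp

theorem ev_binomHAdd_mul (z : ℤ) (m i j l : ℕ) (ν : DistAlg k (CoordRing k)) :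
    DistAlg.ev (monomial k i j l) (binomHAdd k z m * ν) =
      ((Ring.choose (z + (i - j - l) : ℤ) m : ℤ) : k) * DistAlg.ev (monomial k i j l) ν := by
  rw [Ring.add_choose_eq m (Commute.all _ _), binomHAdd, Finset.sum_mul, map_sum, Int.cast_sum,
    Finset.sum_mul]
  refine Finset.sum_congr rfl fun x _ => ?_
  rw [smul_mul_assoc, map_smul, ev_binomH_mul, smul_eq_mul, Int.cast_mul, mul_assoc]

theorem ev_mul_binomHAdd (z : ℤ) (m i j l : ℕ) (ν : DistAlg k (CoordRing k)) :
    DistAlg.ev (monomial k i j l) (ν * binomHAdd k z m) =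
      ((Ring.choose (z + (j - i - l) : ℤ) m : ℤ) : k) * DistAlg.ev (monomial k i j l) ν := by
  rw [Ring.add_choose_eq m (Commute.all _ _), binomHAdd, Finset.mul_sum, map_sum, Int.cast_sum,
    Finset.sum_mul]
  refine Finset.sum_congr rfl fun x _ => ?_
  rw [mul_smul_comm, map_smul, ev_mul_binomH, smul_eq_mul, Int.cast_mul, mul_assoc]

end Action

section ActionModular

variable (p : ℕ) [Fact p.Prime]

/-- `μ_n^{(r)}` acts as the projector onto the weights congruent to `n` modulo `p ^ r`. -/
theorem ev_mu_mul (r : ℕ) (n : ℤ) (i j l : ℕ) (ν : DistSL p) :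
    DistAlg.ev (monomial (ZMod p) i j l) (mu p r n * ν) =
      if ((p ^ r : ℕ) : ℤ) ∣ -n + (i - j - l) then DistAlg.ev (monomial (ZMod p) i j l) ν
      else 0 := by
  rw [mu, Finset.sum_mul, map_sum, ← one_mul (DistAlg.ev (monomial (ZMod p) i j l) ν),
    ← ite_zero_mul, ← sum_neg_one_pow_choose, Finset.sum_mul]
  refine Finset.sum_congr rfl fun x _ => ?_
  rw [smul_mul_assoc, map_smul, ev_binomHAdd_mul, smul_eq_mul, mul_assoc]

theorem ev_mul_mu (r : ℕ) (n : ℤ) (i j l : ℕ) (ν : DistSL p) :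
    DistAlg.ev (monomial (ZMod p) i j l) (ν * mu p r n) =
      if ((p ^ r : ℕ) : ℤ) ∣ -n + (j - i - l) then DistAlg.ev (monomial (ZMod p) i j l) ν
      else 0 := by
  rw [mu, Finset.mul_sum, map_sum, ← one_mul (DistAlg.ev (monomial (ZMod p) i j l) ν),
    ← ite_zero_mul, ← sum_neg_one_pow_choose, Finset.sum_mul]
  refine Finset.sum_congr rfl fun x _ => ?_
  rw [mul_smul_comm, map_smul, ev_mul_binomHAdd, smul_eq_mul, mul_assoc]

theorem ev_divX_mul_mu_mul_divY (a c r : ℕ) (n : ℤ) (i j l : ℕ) :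
    DistAlg.ev (monomial (ZMod p) i j l) (divX (ZMod p) a * mu p r n * divY (ZMod p) c) =
      if i = a ∧ j = c ∧ ((p ^ r : ℕ) : ℤ) ∣ n + (a + c + l) then 1 else 0 := by
  rw [mul_assoc, ev_divX_mul, ev_mu_mul, ev_divY]
  rcases lt_trichotomy i a with h | rfl | h
  · rw [Nat.choose_eq_zero_of_lt h, if_neg (c := i = a ∧ _) (fun h' => h.ne h'.1)]
    simp
  · by_cases hj : j = c
    · subst hj
      simp only [Nat.choose_self, Nat.sub_self, true_and, if_true, Nat.cast_one, one_mul]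
      rw [show -n + (((0 : ℕ) : ℤ) - j - (l + i : ℕ)) = -(n + (i + j + l)) by push_cast; ring]
      simp only [dvd_neg]
    · simp [hj]
  · rw [if_neg (c := i = a ∧ _) (by omega), if_neg (c := i - a = 0 ∧ _) (by omega)]
    simp

theorem ev_divX_mul_divY_mul_mu (a c r : ℕ) (n : ℤ) (i j l : ℕ) :
    DistAlg.ev (monomial (ZMod p) i j l) (divX (ZMod p) a * divY (ZMod p) c * mu p r n) =
      if i = a ∧ j = c ∧ ((p ^ r : ℕ) : ℤ) ∣ -n + (c - a - l) then 1 else 0 := by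
  rw [ev_mul_mu, ev_divX_mul, ev_divY]
  rcases lt_trichotomy i a with h | rfl | h
  · rw [Nat.choose_eq_zero_of_lt h, if_neg (c := i = a ∧ _) (fun h' => h.ne h'.1)]
    simp
  · by_cases hj : j = c
    · subst hj
      simp
    · simp [hj]
  · rw [if_neg (c := i = a ∧ _) (by omega), if_neg (c := i - a = 0 ∧ _) (by omega)]
    simp

end ActionModular

end SLTwo

/-! ### Periodicity, and the Poincaré–Birkhoff–Witt basis -/

namespace SLTwo

section Periodic

variable {p : ℕ}

theorem ev_monomial_mod {q : ℕ} {ν : DistSL p}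
    (h : ∀ m f, DistAlg.ev ((univ (ZMod p)).1 1 1 ^ (q * m) * f) ν = DistAlg.ev f ν)
    (i j l : ℕ) :
    DistAlg.ev (monomial (ZMod p) i j l) ν = DistAlg.ev (monomial (ZMod p) i j (l % q)) ν := by
  rw [← h (l / q) (monomial (ZMod p) i j (l % q))]
  congr 1
  rw [monomial, monomial, mul_left_comm, ← pow_add, Nat.div_add_mod]

/-- A distribution is a finite combination of distributions `P a c r` that are dual, modulo the
periodicity in the exponent of `x₁₁`, to the monomials. -/
theorem eq_sum_ev_smul {q : ℕ} (hq : 0 < q) {ν : DistSL p}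
    (h : ∀ m f, DistAlg.ev ((univ (ZMod p)).1 1 1 ^ (q * m) * f) ν = DistAlg.ev f ν)
    (h0 : ∀ i j l, q ≤ i ∨ q ≤ j → DistAlg.ev (monomial (ZMod p) i j l) ν = 0)
    (P : ℕ → ℕ → ℕ → DistSL p)
    (hP : ∀ a c r i j l, DistAlg.ev (monomial (ZMod p) i j l) (P a c r) =
      if i = a ∧ j = c ∧ (q : ℤ) ∣ r - l then 1 else 0) :
    ν = ∑ s ∈ Finset.range q ×ˢ Finset.range q ×ˢ Finset.range q,
      DistAlg.ev (monomial (ZMod p) s.1 s.2.1 s.2.2) ν • P s.1 s.2.1 s.2.2 := by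
  refine ext_monomial fun i j l => ?_
  rw [map_sum]
  simp only [map_smul, hP, smul_eq_mul]
  have hl : (q : ℤ) ∣ ((l % q : ℕ) : ℤ) - l := by
    rw [Int.natCast_mod]
    exact (Int.mod_modEq _ _).symm.dvd
  rw [Finset.sum_eq_single (i, j, l % q)]
  · rw [if_pos ⟨rfl, rfl, hl⟩, mul_one]
    exact ev_monomial_mod h i j l
  · rintro ⟨a, c, r⟩ hs hne
    simp only [Finset.mem_product, Finset.mem_range] at hs
    rw [if_neg, mul_zero]
    rintro ⟨rfl, rfl, hr⟩
    refine hne ?_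
    have hrl : (r : ℤ) ≡ l [ZMOD q] := (Int.modEq_iff_dvd.2 hr).symm
    have := (Int.natCast_modEq_iff).1 hrl
    rw [← this, Nat.mod_eq_of_lt hs.2.2]
  · intro hs
    simp only [Finset.mem_product, Finset.mem_range, Nat.mod_lt _ hq, and_true, not_and_or,
      not_lt] at hs
    dsimp only
    rw [h0 _ _ _ hs, zero_mul]

end Periodic

section Basis

variable (p : ℕ) [Fact p.Prime]

/-- Since `x₁₁ ^ (p ^ N) - 1 = (x₁₁ - 1) ^ (p ^ N)`, a distribution does not see the factor
`x₁₁ ^ (p ^ N)` when `N` is large; nor does it see high powers of `x₀₁` and `x₁₀`. -/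
theorem exists_periodic (ν : DistSL p) : ∃ b : ℕ,
    (∀ m f, DistAlg.ev ((univ (ZMod p)).1 1 1 ^ (p ^ (1 + b) * m) * f) ν = DistAlg.ev f ν) ∧
    ∀ i j l, p ^ (1 + b) ≤ i ∨ p ^ (1 + b) ≤ j →
      DistAlg.ev (monomial (ZMod p) i j l) ν = 0 := by
  obtain ⟨b, hb⟩ := ν.2
  have hp : p.Prime := Fact.out
  have hle : b ≤ p ^ (1 + b) := (Nat.lt_pow_self hp.one_lt).le.trans
    (Nat.pow_le_pow_right hp.pos (by omega))
  have hI : ∀ f ∈ augIdeal (ZMod p) (CoordRing (ZMod p)) ^ p ^ (1 + b), DistAlg.ev f ν = 0 :=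
    fun f hf => hb f (Ideal.pow_le_pow_right hle hf)
  have h11 := univ_sub_mem_augIdeal (ZMod p) 1 1
  have h01 := univ_sub_mem_augIdeal (ZMod p) 0 1
  have h10 := univ_sub_mem_augIdeal (ZMod p) 1 0
  rw [if_pos rfl] at h11
  rw [if_neg (by decide), sub_zero] at h01 h10
  refine ⟨b, fun m f => ?_, fun i j l h => hI _ ?_⟩
  · have : Nontrivial (CoordRing (ZMod p)) := (counitHom (ZMod p)).toRingHom.domain_nontrivial
    have : CharP (CoordRing (ZMod p)) p :=
      charP_of_injective_algebraMap (algebraMap (ZMod p) (CoordRing (ZMod p))).injective p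
    rw [← sub_eq_zero, mul_comm (p ^ (1 + b)), pow_mul]
    have h : ((univ (ZMod p)).1 1 1 ^ m) ^ p ^ (1 + b) * f - f =
        ((univ (ZMod p)).1 1 1 ^ m - 1) ^ p ^ (1 + b) * f := by
      rw [sub_pow_char_pow, one_pow]
      ring
    refine ((map_sub ν.1.ofConv _ _).symm.trans (congrArg ν.1.ofConv h)).trans (hI _ ?_)
    refine Ideal.mul_mem_right _ _ (Ideal.pow_mem_pow ?_ _)
    have := sub_dvd_pow_sub_pow ((univ (ZMod p)).1 1 1) 1 m
    rw [one_pow] at this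
    exact Ideal.mem_of_dvd _ this h11
  · refine Ideal.mul_mem_right _ _ ?_
    rcases h with h | h
    · exact Ideal.mul_mem_right _ _ (Ideal.pow_le_pow_right h (Ideal.pow_mem_pow h01 i))
    · exact Ideal.mul_mem_left _ _ (Ideal.pow_le_pow_right h (Ideal.pow_mem_pow h10 j))

theorem span_divX_mul_mu_mul_divY : Submodule.span (ZMod p)
    {x : DistSL p | ∃ (a b c : ℕ) (n : ℤ),
      x = divX (ZMod p) a * mu p (1 + b) n * divY (ZMod p) c} = ⊤ := by
  rw [eq_top_iff]
  intro ν _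
  obtain ⟨b, h, h0⟩ := exists_periodic p ν
  rw [eq_sum_ev_smul (pow_pos (Fact.out : p.Prime).pos _) h h0
    (fun a c r => divX (ZMod p) a * mu p (1 + b) (-(a + c + r)) * divY (ZMod p) c) ?_]
  · exact Submodule.sum_mem _ fun s _ => Submodule.smul_mem _ _
      (Submodule.subset_span ⟨_, _, _, _, rfl⟩)
  · intro a c r i j l
    rw [ev_divX_mul_mu_mul_divY, show (-(a + c + r) + (a + c + l) : ℤ) = -(r - l) by ring]
    simp only [dvd_neg]

theorem mu_mem_span_binomH (r : ℕ) (n : ℤ) :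
    mu p r n ∈ Submodule.span (ZMod p) (Set.range (binomH (ZMod p))) :=
  Submodule.sum_mem _ fun _ _ => Submodule.smul_mem _ _ (Submodule.sum_mem _ fun _ _ =>
    Submodule.smul_mem _ _ (Submodule.subset_span ⟨_, rfl⟩))

/-- The Poincaré–Birkhoff–Witt monomials `X^{(a)} binom(H, m) Y^{(c)}`. -/
noncomputable def pbw (s : ℕ × ℕ × ℕ) : DistSL p :=
  divX (ZMod p) s.1 * binomH (ZMod p) s.2.1 * divY (ZMod p) s.2.2

theorem mul_mem_span_pbw {h : DistSL p}
    (hh : h ∈ Submodule.span (ZMod p) (Set.range (binomH (ZMod p)))) (a c : ℕ) :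
    divX (ZMod p) a * h * divY (ZMod p) c ∈ Submodule.span (ZMod p) (Set.range (pbw p)) := by
  induction hh using Submodule.span_induction with
  | mem x hx =>
    obtain ⟨m, rfl⟩ := hx
    exact Submodule.subset_span ⟨(a, m, c), rfl⟩
  | zero => simp
  | add x y _ _ hx hy =>
    rw [mul_add, add_mul]
    exact Submodule.add_mem _ hx hy
  | smul r x _ hx =>
    rw [mul_smul_comm, smul_mul_assoc]
    exact Submodule.smul_mem _ r hx

theorem span_pbw : ⊤ ≤ Submodule.span (ZMod p) (Set.range (pbw p)) := by
  rw [← span_divX_mul_mu_mul_divY, Submodule.span_le]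
  rintro _ ⟨a, b, c, n, rfl⟩
  exact mul_mem_span_pbw p (mu_mem_span_binomH p _ _) a c

/-- By periodicity the functions `binom(-(i + j + l), m)` of `l` determine the functions
`binom(z, m)` of `z`, which form a unitriangular system. -/
theorem linearIndependent_pbw : LinearIndependent (ZMod p) (pbw p) := by
  rw [linearIndependent_iff]
  intro x hx
  have key : ∀ m i j, x (i, m, j) = 0 := by
    intro m
    induction m using Nat.strong_induction_on with
    | _ m ih =>
      intro i j
      -- `p ^ N` exceeds `m` and all the degrees occurring in `x`.
      set N := m + x.support.sup (fun s => s.2.1)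
      have hN : ∀ n ≤ N, n < p ^ N := fun n hn =>
        hn.trans_lt (Nat.lt_pow_self (Fact.out : p.Prime).one_lt)
      -- A value of `l` for which the weight `-(i + j + l)` is congruent to `m`.
      obtain ⟨l, -, hl⟩ := exists_nat_modEq p N (-(i + j + m))
      have hl' : (-(i + j + l) : ℤ) ≡ (m : ℕ) [ZMOD (p ^ N : ℕ)] := by
        have := (hl.add_right (i + j : ℤ)).neg
        ring_nf at this ⊢
        exact this.symm
      have h := congrArg (DistAlg.ev (monomial (ZMod p) i j l)) hx
      rw [Finsupp.linearCombination_apply, Finsupp.sum, map_sum, map_zero,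
        Finset.sum_eq_single (i, m, j)] at h
      · rw [map_smul, pbw, ev_pbw, if_pos ⟨rfl, rfl⟩, choose_eq_of_modEq p (hN m (by omega)) hl',
          Ring.choose_natCast, Nat.choose_self] at h
        simpa using h
      · rintro ⟨a, n, c⟩ hs hne
        rw [map_smul, pbw, ev_pbw]
        split_ifs with hac
        · obtain ⟨rfl, rfl⟩ := hac
          have hn : n ≤ N := (Finset.le_sup (f := fun s : ℕ × ℕ × ℕ => s.2.1) hs).trans
            (Nat.le_add_left _ _)
          dsimp only
          rw [choose_eq_of_modEq p (hN n hn) hl', Ring.choose_natCast]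
          rcases lt_trichotomy n m with hlt | rfl | hlt
          · rw [ih n hlt, zero_smul]
          · exact absurd rfl hne
          · rw [Nat.choose_eq_zero_of_lt hlt]
            simp
        · rw [smul_zero]
      · intro hs
        rw [Finsupp.notMem_support_iff.1 hs, zero_smul, map_zero]
  ext ⟨i, m, j⟩
  exact key m i j

end Basis

/-! ### The contraction `Fr'` -/

section Contraction

variable (p : ℕ) [Fact p.Prime]

/-- The linear map sending `X^{(a)} binom(H, m) Y^{(c)}` to
`X^{(pa)} binom(H, pm) Y^{(pc)}`. -/
noncomputable def frPrime : DistSL p →ₗ[ZMod p] DistSL p :=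
  (Module.Basis.mk (linearIndependent_pbw p) (span_pbw p)).constr (ZMod p)
    fun s => pbw p (p * s.1, p * s.2.1, p * s.2.2)

theorem frPrime_pbw (a m c : ℕ) :
    frPrime p (divX (ZMod p) a * binomH (ZMod p) m * divY (ZMod p) c) =
      divX (ZMod p) (p * a) * binomH (ZMod p) (p * m) * divY (ZMod p) (p * c) := by
  have h := Module.Basis.mk_apply (linearIndependent_pbw p) (span_pbw p) (a, m, c)
  change frPrime p (pbw p (a, m, c)) = pbw p (p * a, p * m, p * c)
  rw [← h, frPrime, Module.Basis.constr_basis]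

theorem frPrime_binomH (m : ℕ) :
    frPrime p (binomH (ZMod p) m) = binomH (ZMod p) (p * m) := by
  have := frPrime_pbw p 0 m 0
  simpa [divX_zero, divY_zero] using this

theorem isFrPrime_frPrime : IsFrPrime p (frPrime p) := by
  refine ⟨frPrime_binomH p, fun a b c n => ?_⟩
  have hmu := mu_mem_span_binomH p (1 + b) n
  generalize mu p (1 + b) n = h at hmu
  induction hmu using Submodule.span_induction with
  | mem x hx =>
    obtain ⟨m, rfl⟩ := hx
    rw [frPrime_pbw, frPrime_binomH]
  | zero => simp
  | add x y _ _ hx hy => simp only [mul_add, add_mul, map_add, hx, hy]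
  | smul r x _ hx => simp only [mul_smul_comm, smul_mul_assoc, map_smul, hx]

variable {p} in
theorem IsFrPrime.eq_frPrime {F : DistSL p →ₗ[ZMod p] DistSL p} (hF : IsFrPrime p F) :
    F = frPrime p := by
  have hT : ∀ h ∈ Submodule.span (ZMod p) (Set.range (binomH (ZMod p))),
      F h = frPrime p h := by
    refine fun h hh => LinearMap.eqOn_span ?_ hh
    rintro _ ⟨m, rfl⟩
    rw [hF.1, frPrime_binomH]
  refine LinearMap.ext_on (span_divX_mul_mu_mul_divY p) ?_
  rintro _ ⟨a, b, c, n, rfl⟩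
  rw [hF.2, (isFrPrime_frPrime p).2, hT _ (mu_mem_span_binomH p _ _)]

end Contraction

end SLTwo

/-! ### Distributions supported on `p`-th powers -/

namespace SLTwo

section Frobenius

variable (p : ℕ) [Fact p.Prime]

/-- The distributions whose value on a monomial `x₀₁ ^ i * x₁₀ ^ j * x₁₁ ^ l` vanishes unless the
monomial is a `p`-th power. -/
noncomputable def powSupported : Submodule (ZMod p) (DistSL p) where
  carrier := {ν | ∀ i j l, ¬ (p ∣ i ∧ p ∣ j ∧ p ∣ l) →
    DistAlg.ev (monomial (ZMod p) i j l) ν = 0}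
  add_mem' := by
    intro x y hx hy i j l h
    rw [map_add, hx i j l h, hy i j l h, add_zero]
  zero_mem' := fun _ _ _ _ => map_zero _
  smul_mem' := by
    intro r x hx i j l h
    rw [map_smul, hx i j l h, smul_zero]

variable {p}

theorem dvd_of_mem_powSupported {ν : DistSL p} (hν : ν ∈ powSupported p) {i j l : ℕ}
    (h : DistAlg.ev (monomial (ZMod p) i j l) ν ≠ 0) : p ∣ i ∧ p ∣ j ∧ p ∣ l :=
  not_not.1 fun h' => h (hν i j l h')

theorem divX_mul_mem_powSupported (a : ℕ) {ν : DistSL p} (hν : ν ∈ powSupported p) :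
    divX (ZMod p) (p * a) * ν ∈ powSupported p := by
  intro i j l h
  rw [ev_divX_mul]
  by_contra hne
  have hi : p * a ≤ i := by
    by_contra hi
    exact left_ne_zero_of_mul hne (by rw [Nat.choose_eq_zero_of_lt (by omega), Nat.cast_zero])
  obtain ⟨h1, h2, h3⟩ := dvd_of_mem_powSupported hν (right_ne_zero_of_mul hne)
  refine h ⟨?_, h2, (Nat.dvd_add_left (dvd_mul_right p a)).1 h3⟩
  have := dvd_add h1 (dvd_mul_right p a)
  rwa [Nat.sub_add_cancel hi] at this

theorem mu_mul_mem_powSupported (r : ℕ) (n : ℤ) {ν : DistSL p} (hν : ν ∈ powSupported p) :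
    mu p r n * ν ∈ powSupported p := by
  intro i j l h
  rw [ev_mu_mul, hν i j l h, ite_self]

/-- The left translate of a monomial under `u ↦ (1 0; u 1)` involves `x₀₀`; after multiplication
by a power of `x₁₁` this entry is eliminated by means of
`x₁₁ * (x₁₀ + u * x₀₀) = u + x₁₀ * (x₁₁ + u * x₀₁)`. -/
theorem leftTranslate_lower_monomial (k : Type*) [CommRing k] (Q i j l : ℕ) :
    PowerSeries.C ((univ k).1 1 1 ^ (Q * j + j)) *
        leftTranslate (point (lower k)) (monomial k i j l) =
      ∑ β ∈ Finset.range (j + 1), ∑ γ ∈ Finset.range (l + β + 1),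
        PowerSeries.X ^ (j - β + γ) * PowerSeries.C (((j.choose β * (l + β).choose γ : ℕ) : k) •
          monomial k (i + γ) β (l + β - γ + Q * j)) := by
  have hdet : (PowerSeries.C ((univ k).1 0 0) * PowerSeries.C ((univ k).1 1 1) :
      PowerSeries (CoordRing k)) =
      1 + PowerSeries.C ((univ k).1 0 1) * PowerSeries.C ((univ k).1 1 0) := by
    rw [← map_mul, univ_det, map_add, map_one, map_mul]
  simp only [monomial, map_mul, map_pow, leftTranslate_point, Fin.sum_univ_two]
  simp only [lower, Matrix.of_apply, Matrix.cons_val', Matrix.cons_val_zero, Matrix.cons_val_one,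
    map_zero, map_one, one_mul, zero_mul, add_zero, PowerSeries.map_X, Algebra.smul_def,
    map_natCast, map_mul, map_pow]
  generalize (PowerSeries.C ((univ k).1 0 0) : PowerSeries (CoordRing k)) = a at *
  generalize (PowerSeries.C ((univ k).1 0 1) : PowerSeries (CoordRing k)) = b at *
  generalize (PowerSeries.C ((univ k).1 1 0) : PowerSeries (CoordRing k)) = c at *
  generalize (PowerSeries.C ((univ k).1 1 1) : PowerSeries (CoordRing k)) = d at *
  have h1 : d ^ (Q * j + j) * (b ^ i * (PowerSeries.X * a + c) ^ j * (PowerSeries.X * b + d) ^ l) =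
      d ^ (Q * j) * b ^ i * ((c * (PowerSeries.X * b + d) + PowerSeries.X) ^ j *
        (PowerSeries.X * b + d) ^ l) := by
    have : c * (PowerSeries.X * b + d) + PowerSeries.X = d * (PowerSeries.X * a + c) := by
      linear_combination (-PowerSeries.X) * hdet
    rw [this, mul_pow, pow_add]
    ring
  rw [h1, add_pow, Finset.sum_mul, Finset.mul_sum]
  refine Finset.sum_congr rfl fun β _ => ?_
  have h2 : (c * (PowerSeries.X * b + d)) ^ β * PowerSeries.X ^ (j - β) *
      (j.choose β : PowerSeries (CoordRing k)) * (PowerSeries.X * b + d) ^ l =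
      c ^ β * PowerSeries.X ^ (j - β) * (j.choose β : PowerSeries (CoordRing k)) *
        (PowerSeries.X * b + d) ^ (l + β) := by
    rw [mul_pow, pow_add]
    ring
  rw [h2, add_pow, Finset.mul_sum, Finset.mul_sum]
  refine Finset.sum_congr rfl fun γ _ => ?_
  push_cast
  ring

/-- In a term of `leftTranslate_lower_monomial` on which `ν` does not vanish, all exponents are
divisible by `p`, and so is the exponent of `u`; Lucas' theorem then forces `p ∣ γ`. -/
theorem divY_mul_mem_powSupported (n : ℕ) {ν : DistSL p} (hν : ν ∈ powSupported p) :
    divY (ZMod p) (p * n) * ν ∈ powSupported p := by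
  intro i j l hijl
  obtain ⟨b, h, -⟩ := exists_periodic p ν
  obtain ⟨Q, hQ⟩ : ∃ Q, p ^ (1 + b) = Q + 1 :=
    Nat.exists_eq_add_one.2 (pow_pos (Fact.out : p.Prime).pos _)
  have hpQ : p ∣ Q + 1 := hQ ▸ dvd_pow_self p (by omega)
  -- `ν` does not see the factor `x₁₁ ^ ((Q + 1) * j)` inserted here.
  rw [divY, DistAlg.ev_ofCurve_mul, ← h j, hQ, ← PowerSeries.coeff_C_mul,
    show (Q + 1) * j = Q * j + j by ring, leftTranslate_lower_monomial, map_sum, DistAlg.ev_sum]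
  refine Finset.sum_eq_zero fun β hβ => ?_
  rw [map_sum, DistAlg.ev_sum]
  refine Finset.sum_eq_zero fun γ hγ => ?_
  rw [PowerSeries.coeff_X_pow_mul', PowerSeries.coeff_C]
  split_ifs with h1 h2
  · rw [DistAlg.ev_smul]
    by_contra hne
    have hchoose := left_ne_zero_of_mul hne
    obtain ⟨d1, d2, d3⟩ := dvd_of_mem_powSupported hν (right_ne_zero_of_mul hne)
    rw [Nat.cast_mul] at hchoose
    have hβj : β ≤ j := Nat.lt_succ_iff.1 (Finset.mem_range.1 hβ)
    have hγl : γ ≤ l + β := Nat.lt_succ_iff.1 (Finset.mem_range.1 hγ)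
    have d4 : p ∣ j - β + γ := by
      rw [show j - β + γ = p * n by omega]
      exact dvd_mul_right p n
    zify [hβj, hγl] at d1 d2 d3 d4 hpQ
    -- `l + β - γ + Q * j` and `j - β + γ` add up to `l + (Q + 1) * j`.
    have dl : (p : ℤ) ∣ l := by
      have := (dvd_add d3 d4).sub (dvd_mul_of_dvd_left hpQ (j : ℤ))
      ring_nf at this
      exact this
    have dγ : p ∣ γ := dvd_of_choose_ne_zero p
      (by zify; exact dvd_add dl d2) (right_ne_zero_of_mul hchoose)
    zify at dγ
    refine hijl ⟨?_, ?_, ?_⟩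
    · have := d1.sub dγ
      rw [add_sub_cancel_right] at this
      exact_mod_cast this
    · have := (d4.sub dγ).add d2
      ring_nf at this
      exact_mod_cast this
    · exact_mod_cast dl
  · exact DistAlg.ev_zero ν
  · exact DistAlg.ev_zero ν

theorem divX_mul_divY_mul_mu_mem_powSupported (a b c : ℕ) (n : ℤ) :
    divX (ZMod p) (p * a) * divY (ZMod p) (p * c) * mu p (1 + b) (n * p) ∈ powSupported p := by
  intro i j l h
  rw [ev_divX_mul_divY_mul_mu, if_neg]
  rintro ⟨rfl, rfl, hd⟩
  refine h ⟨dvd_mul_right _ _, dvd_mul_right _ _, ?_⟩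
  have h1 : (p : ℤ) ∣ (p ^ (1 + b) : ℕ) := by
    exact_mod_cast dvd_pow_self p (by omega)
  have h2 := (Dvd.intro (c - a - n) rfl : (p : ℤ) ∣ p * (c - a - n)).sub (h1.trans hd)
  push_cast at h2
  ring_nf at h2
  exact_mod_cast h2

/-- The index `n` of `μ_n^{(r)}` only matters modulo `p ^ r`, so that the restriction
`0 ≤ n < p ^ b` in the definition of `spanFr` is harmless. -/
theorem mem_spanFr (a b c : ℕ) (n : ℤ) :
    divX (ZMod p) (p * a) * divY (ZMod p) (p * c) * mu p (1 + b) (n * p) ∈ spanFr p := by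
  obtain ⟨r, hr, hn⟩ := exists_nat_modEq p b n
  refine Submodule.subset_span ⟨a, b, c, r, hr, ext_monomial fun i j l => ?_⟩
  have hd : ((p ^ (1 + b) : ℕ) : ℤ) ∣ n * p - r * p := by
    rw [← sub_mul, add_comm, pow_succ]
    push_cast
    exact mul_dvd_mul_right (by exact_mod_cast hn.symm.dvd) _
  rw [ev_divX_mul_divY_mul_mu, ev_divX_mul_divY_mul_mu]
  refine if_congr (and_congr_right fun _ => and_congr_right fun _ => ?_) rfl rfl
  rw [← dvd_add_right hd]
  push_cast
  ring_nf

theorem spanFr_eq_powSupported : spanFr p = powSupported p := by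
  refine le_antisymm (Submodule.span_le.2 ?_) fun ν hν => ?_
  · rintro _ ⟨a, b, c, n, -, rfl⟩
    rw [Nat.cast_mul]
    exact divX_mul_divY_mul_mu_mem_powSupported a b c n
  · obtain ⟨b, h, h0⟩ := exists_periodic p ν
    rw [eq_sum_ev_smul (pow_pos (Fact.out : p.Prime).pos _) h h0
      (fun a c r => divX (ZMod p) a * divY (ZMod p) c * mu p (1 + b) (c - a - r)) ?_]
    · refine Submodule.sum_mem _ fun s _ => ?_
      obtain ⟨a, c, r⟩ := s
      by_cases hs : p ∣ a ∧ p ∣ c ∧ p ∣ r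
      · obtain ⟨⟨a, rfl⟩, ⟨c, rfl⟩, ⟨r, rfl⟩⟩ := hs
        refine Submodule.smul_mem _ _ ?_
        have := mem_spanFr (p := p) a b c (c - a - r)
        rw [show ((c - a - r) * p : ℤ) = (p * c : ℕ) - (p * a : ℕ) - (p * r : ℕ) by
          push_cast; ring] at this
        exact this
      · rw [hν a c r hs, zero_smul]
        exact Submodule.zero_mem _
    · intro a c r i j l
      rw [ev_divX_mul_divY_mul_mu, show (-(c - a - r) + (c - a - l) : ℤ) = r - l by ring]

theorem mul_mem_powSupported {x y : DistSL p} (hx : x ∈ powSupported p)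
    (hy : y ∈ powSupported p) : x * y ∈ powSupported p := by
  rw [← spanFr_eq_powSupported, spanFr] at hx
  induction hx using Submodule.span_induction with
  | mem x hx =>
    obtain ⟨a, b, c, n, -, rfl⟩ := hx
    rw [mul_assoc, mul_assoc]
    exact divX_mul_mem_powSupported a
      (divY_mul_mem_powSupported c (mu_mul_mem_powSupported _ _ hy))
  | zero => rw [zero_mul]; exact Submodule.zero_mem _
  | add x z _ _ hx hz => rw [add_mul]; exact Submodule.add_mem _ hx hz
  | smul r x _ hx => rw [smul_mul_assoc]; exact Submodule.smul_mem _ r hx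

theorem mu_zero_mul {x : DistSL p} (hx : x ∈ powSupported p) : mu p 1 0 * x = x := by
  refine ext_monomial fun i j l => ?_
  rw [ev_mu_mul]
  split_ifs with h
  · rfl
  · refine (hx i j l fun ⟨hi, hj, hl⟩ => h ?_).symm
    zify at hi hj hl
    simpa using (hi.sub hj).sub hl

theorem mul_mu_zero {x : DistSL p} (hx : x ∈ powSupported p) : x * mu p 1 0 = x := by
  refine ext_monomial fun i j l => ?_
  rw [ev_mul_mu]
  split_ifs with h
  · rfl
  · refine (hx i j l fun ⟨hi, hj, hl⟩ => h ?_).symm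
    zify at hi hj hl
    simpa using (hj.sub hi).sub hl

/-! ### The splitting of `Dist(Fr)` -/

theorem ev_distFr (x : DistSL p) (i j l : ℕ) :
    DistAlg.ev (monomial (ZMod p) i j l) (distFr p x) =
      DistAlg.ev (monomial (ZMod p) (p * i) (p * j) (p * l)) x := by
  change DistAlg.ev (FiniteField.frobeniusAlgHom (ZMod p) _ (monomial (ZMod p) i j l)) x = _
  rw [FiniteField.frobeniusAlgHom_apply, ZMod.card, monomial, mul_pow, mul_pow, ← pow_mul,
    ← pow_mul, ← pow_mul, mul_comm i, mul_comm j, mul_comm l, ← monomial]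

theorem distFr_mul (x y : DistSL p) : distFr p (x * y) = distFr p x * distFr p y := by
  refine DistAlg.comap_mul _ _ (AlgHom.ext fun f => ?_) x y
  have h : (FiniteField.frobeniusAlgHom (ZMod p)
      (CoordRing (ZMod p) ⊗[ZMod p] CoordRing (ZMod p))) =
      Algebra.TensorProduct.map (FiniteField.frobeniusAlgHom (ZMod p) (CoordRing (ZMod p)))
        (FiniteField.frobeniusAlgHom (ZMod p) (CoordRing (ZMod p))) :=
    Algebra.TensorProduct.ext' fun a b => by
      simp [FiniteField.frobeniusAlgHom_apply, Algebra.TensorProduct.tmul_pow]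
  rw [AlgHom.comp_apply, AlgHom.comp_apply, ← h, FiniteField.frobeniusAlgHom_apply,
    FiniteField.frobeniusAlgHom_apply, map_pow]

theorem eq_zero_of_distFr_eq_zero {x : DistSL p} (hx : x ∈ powSupported p)
    (h : distFr p x = 0) : x = 0 := by
  refine ext_monomial fun i j l => ?_
  rw [map_zero]
  by_contra hne
  obtain ⟨⟨i, rfl⟩, ⟨j, rfl⟩, ⟨l, rfl⟩⟩ := dvd_of_mem_powSupported hx hne
  rw [← ev_distFr, h, map_zero] at hne
  exact hne rfl

theorem ev_frPrime_pbw_mul_mu (a m c i j l : ℕ) :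
    DistAlg.ev (monomial (ZMod p) i j l) (frPrime p (pbw p (a, m, c)) * mu p 1 0) =
      if (p : ℤ) ∣ j - i - l ∧ i = p * a ∧ j = p * c then
        ((Ring.choose (-(p * a + p * c + l) : ℤ) (p * m) : ℤ) : ZMod p) else 0 := by
  rw [pbw, frPrime_pbw, ev_mul_mu, ev_pbw, pow_one, neg_zero, zero_add, ← ite_and]
  push_cast
  rfl

theorem frPrime_mul_mu_mem (x : DistSL p) : frPrime p x * mu p 1 0 ∈ powSupported p := by
  have hx := span_pbw p (Submodule.mem_top (x := x))
  induction hx using Submodule.span_induction with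
  | mem x hx =>
    obtain ⟨⟨a, m, c⟩, rfl⟩ := hx
    intro i j l h
    rw [ev_frPrime_pbw_mul_mu, if_neg]
    rintro ⟨hd, rfl, rfl⟩
    refine h ⟨dvd_mul_right _ _, dvd_mul_right _ _, ?_⟩
    have := (Dvd.intro (c - a) rfl : (p : ℤ) ∣ p * (c - a)).sub hd
    push_cast at this
    ring_nf at this
    exact_mod_cast this
  | zero => rw [map_zero, zero_mul]; exact Submodule.zero_mem _
  | add x y _ _ hx hy => rw [map_add, add_mul]; exact Submodule.add_mem _ hx hy
  | smul r x _ hx => rw [map_smul, smul_mul_assoc]; exact Submodule.smul_mem _ r hx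

theorem distFr_frPrime_mul_mu (x : DistSL p) : distFr p (frPrime p x * mu p 1 0) = x := by
  have hx := span_pbw p (Submodule.mem_top (x := x))
  induction hx using Submodule.span_induction with
  | mem x hx =>
    obtain ⟨⟨a, m, c⟩, rfl⟩ := hx
    refine ext_monomial fun i j l => ?_
    have hp : p ≠ 0 := (Fact.out : p.Prime).ne_zero
    have hd : (p : ℤ) ∣ (p * j : ℕ) - (p * i : ℕ) - (p * l : ℕ) :=
      ⟨j - i - l, by push_cast; ring⟩
    rw [ev_distFr, ev_frPrime_pbw_mul_mu, pbw, ev_pbw]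
    simp only [hd, true_and, mul_right_inj' hp]
    rw [show (-(p * a + p * c + (p * l : ℕ)) : ℤ) = p * -(a + c + l) by push_cast; ring,
      choose_prime_mul]
  | zero => rw [map_zero, zero_mul, map_zero]
  | add x y _ _ hx hy => rw [map_add, add_mul, map_add, hx, hy]
  | smul r x _ hx => rw [map_smul, smul_mul_assoc, map_smul, hx]

theorem frPrime_distFr_mul_mu {x : DistSL p} (hx : x ∈ powSupported p) :
    frPrime p (distFr p x) * mu p 1 0 = x := by
  rw [← sub_eq_zero]
  refine eq_zero_of_distFr_eq_zero (Submodule.sub_mem _ (frPrime_mul_mu_mem _) hx) ?_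
  rw [map_sub, distFr_frPrime_mul_mu, sub_self]

theorem frPrime_mul_mul_mu (x y : DistSL p) : frPrime p (x * y) * mu p 1 0 =
    frPrime p x * mu p 1 0 * (frPrime p y * mu p 1 0) := by
  rw [← frPrime_distFr_mul_mu (mul_mem_powSupported (frPrime_mul_mu_mem x) (frPrime_mul_mu_mem y)),
    distFr_mul, distFr_frPrime_mul_mu, distFr_frPrime_mul_mu]

theorem frPrime_one : frPrime p 1 = 1 := by
  rw [← binomH_zero, frPrime_binomH, mul_zero]

variable (p) in
/-- The non-unital subalgebra `S`, the span of the `X^{(pa)} Y^{(pc)} μ_{np}^{(1+b)}`. -/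
noncomputable def subalgebraFr : NonUnitalSubalgebra (ZMod p) (DistSL p) :=
  { spanFr p with
    mul_mem' := fun {x y} hx hy => by
      have hx : x ∈ spanFr p := hx
      have hy : y ∈ spanFr p := hy
      change x * y ∈ spanFr p
      rw [spanFr_eq_powSupported] at hx hy ⊢
      exact mul_mem_powSupported hx hy }

theorem mem_subalgebraFr {x : DistSL p} : x ∈ subalgebraFr p ↔ x ∈ powSupported p := by
  rw [← spanFr_eq_powSupported]
  rfl

variable (p) in
/-- The bijection `φ : Dist(SL₂) → S`, `φ(μ) = Fr'(μ) μ₀`, with inverse `Dist(Fr)`. -/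
noncomputable def frEquiv : DistSL p ≃ₗ[ZMod p] subalgebraFr p where
  toFun x := ⟨frPrime p x * mu p 1 0, mem_subalgebraFr.2 (frPrime_mul_mu_mem x)⟩
  map_add' x y := Subtype.ext (by
    change frPrime p (x + y) * mu p 1 0 = frPrime p x * mu p 1 0 + frPrime p y * mu p 1 0
    rw [map_add, add_mul])
  map_smul' r x := Subtype.ext (by
    change frPrime p (r • x) * mu p 1 0 = r • (frPrime p x * mu p 1 0)
    rw [map_smul, smul_mul_assoc])
  invFun y := distFr p y
  left_inv := distFr_frPrime_mul_mu
  right_inv y := Subtype.ext (frPrime_distFr_mul_mu (mem_subalgebraFr.1 y.2))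

theorem coe_frEquiv (x : DistSL p) :
    (frEquiv p x : DistSL p) = frPrime p x * mu p 1 0 := rfl

end Frobenius

end SLTwo

theorem mainTheorem3 (p : ℕ) [Fact p.Prime] :
    (∃! F : SLTwo.DistSL p →ₗ[ZMod p] SLTwo.DistSL p, SLTwo.IsFrPrime p F) ∧
    ∀ F : SLTwo.DistSL p →ₗ[ZMod p] SLTwo.DistSL p, SLTwo.IsFrPrime p F →
      ∃ S : NonUnitalSubalgebra (ZMod p) (SLTwo.DistSL p),
        S.toSubmodule = SLTwo.spanFr p ∧
        SLTwo.mu p 1 0 ∈ S ∧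
        (∀ x ∈ S, SLTwo.mu p 1 0 * x = x ∧ x * SLTwo.mu p 1 0 = x) ∧
        ∃ φ : SLTwo.DistSL p ≃ₗ[ZMod p] S,
          (∀ μ, (φ μ : SLTwo.DistSL p) = F μ * SLTwo.mu p 1 0) ∧
          (∀ μ, (φ μ : SLTwo.DistSL p) = SLTwo.mu p 1 0 * F μ * SLTwo.mu p 1 0) ∧
          (φ 1 : SLTwo.DistSL p) = SLTwo.mu p 1 0 ∧
          (∀ μ ν, φ (μ * ν) = φ μ * φ ν) ∧
          ∀ μ, SLTwo.distFr p (φ μ) = μ := by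
  refine ⟨⟨SLTwo.frPrime p, SLTwo.isFrPrime_frPrime p, fun F hF => hF.eq_frPrime⟩,
    fun F hF => ?_⟩
  obtain rfl := hF.eq_frPrime
  have h1 : (SLTwo.frEquiv p 1 : SLTwo.DistSL p) = SLTwo.mu p 1 0 := by
    rw [SLTwo.coe_frEquiv, SLTwo.frPrime_one, one_mul]
  refine ⟨SLTwo.subalgebraFr p, rfl, h1 ▸ (SLTwo.frEquiv p 1).2, fun x hx => ?_,
    SLTwo.frEquiv p, SLTwo.coe_frEquiv, fun μ => ?_, h1, fun μ ν => ?_,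
    SLTwo.distFr_frPrime_mul_mu⟩
  · have hx := SLTwo.mem_subalgebraFr.1 hx
    exact ⟨SLTwo.mu_zero_mul hx, SLTwo.mul_mu_zero hx⟩
  · rw [SLTwo.coe_frEquiv, mul_assoc, SLTwo.mu_zero_mul (SLTwo.frPrime_mul_mu_mem μ)]
  · exact Subtype.ext (SLTwo.frPrime_mul_mul_mu μ ν)
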